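/- Let $\alpha\ge \tfrac13$, $\beta\in(0,\tfrac1\alpha)$, $\epsilon\in(0,\min(1,\beta))$ and $K,L\in\mathbb R$. Then there is a constant $C=C(\alpha,\beta,\epsilon,K,L)>0$ with the following property. Let $M_0\subset\mathbb R^2$ be a smooth, strictly convex (that is, of positive curvature), complete, non-compact embedded curve whose two ends are asymptotic to the lines $\{x_1=-1\}$ and $\{x_1=1\}$ as $x_2\to+\infty$, and let $M_t=X(\mathbb R,t)$, $t\in[0,\infty)$, be a smooth strictly convex complete solution of the $\alpha$-curve shortening flow with initial curve $M_0$, that is $$\partial_t X(p,t)=\bar\kappa^\alpha(p,t)\,n(p,t),$$ where $\bar\kappa>0$ is the curvature of $M_t$ at $X(p,t)$ and $n$ is the unit normal pointing into the convex hull of $M_t$ (smoothness in $(p,t)$ is required for $t>0$ only, with continuity up to $t=0$). Put $u:=\bar\kappa^\alpha$, let $u_s,u_{ss}$ denote its first and second derivatives with respect to the arc length $s$ of $M_t$, and let $B_r=\{x\in\mathbb R^2:|x|<r\}$. Suppose that for all $t\ge0$ $$|u_s|\le K\,u^\beta\quad\text{and}\quad u\le L\qquad\text{at all points of } M_t\cap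 B_1 .$$ Then for all $t>0$ $$|u_{ss}|\le C\,(1+t^{-1/2})\,u^{\min(\beta,\,2\beta-1)-\epsilon}\qquad\text{at all points of } M_t\cap B_{1/2}.$$ -/

import Mathlib

open scoped ContDiff

noncomputable section

/-- The Euclidean plane. -/
abbrev Plane : Type := EuclideanSpace ℝ (Fin 2)

/-- The rotation of the plane by the angle `π / 2`, counterclockwise. -/
def rotate (v : Plane) : Plane := !₂[-(v 1), v 0]

/-- The derivative `∂_s f` of a function `f` along a parametrized curve `γ` with respect to the
arc length `s` of `γ`, that is `∂_s = |γ'|⁻¹ ∂_p`. -/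
def arcDeriv {F : Type*} [NormedAddCommGroup F] [NormedSpace ℝ F]
    (γ : ℝ → Plane) (f : ℝ → F) (p : ℝ) : F :=
  ‖deriv γ p‖⁻¹ • deriv f p

/-- The unit tangent vector `∂_s γ`. -/
def unitTangent (γ : ℝ → Plane) (p : ℝ) : Plane := arcDeriv γ γ p

/-- The unit normal vector, to the left of the unit tangent vector. On a convex curve that is
oriented so as to have positive curvature it points into the convex hull. -/
def unitNormal (γ : ℝ → Plane) (p : ℝ) : Plane := rotate (unitTangent γ p)

/-- The (signed) curvature `⟨∂_s ∂_s γ, n⟩` of a parametrized plane curve. -/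
def curvature (γ : ℝ → Plane) (p : ℝ) : ℝ :=
  inner ℝ (arcDeriv γ (unitTangent γ) p) (unitNormal γ p)

/-- `γ` is a parametrization of a smooth, strictly convex, complete, non-compact embedded plane
curve: a smooth immersion and a closed embedding of the real line, whose image bounds its convex
hull, oriented so that the curvature is positive. -/
structure IsStrictlyConvexCompleteCurve (γ : ℝ → Plane) : Prop where
  contDiff : ContDiff ℝ ∞ γ
  immersion : ∀ p, deriv γ p ≠ 0
  isClosedEmbedding : Topology.IsClosedEmbedding γ
  convex : frontier (convexHull ℝ (Set.range γ)) = Set.range γ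
  curvature_pos : ∀ p, 0 < curvature γ p

/-- The two ends of `γ` are asymptotic to the lines `x₁ = -1` and `x₁ = 1` as `x₂ → +∞`.
(A curve of positive curvature that opens upwards runs from left to right.) -/
structure EndsAsymptoticToLines (γ : ℝ → Plane) : Prop where
  left_fst : Filter.Tendsto (fun p => γ p 0) Filter.atBot (nhds (-1))
  left_snd : Filter.Tendsto (fun p => γ p 1) Filter.atBot Filter.atTop
  right_fst : Filter.Tendsto (fun p => γ p 0) Filter.atTop (nhds 1)
  right_snd : Filter.Tendsto (fun p => γ p 1) Filter.atTop Filter.atTop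

/-- `X = X(p, t)` is a strictly convex complete solution, for all times `t ≥ 0`, of the
`α`-curve shortening flow `∂_t X = κ ^ α n`. It is smooth for `t > 0` and attains its initial
curve `X(·, 0)` continuously. -/
structure IsAlphaCSF (α : ℝ) (X : ℝ → ℝ → Plane) : Prop where
  continuousOn : ContinuousOn (Function.uncurry X) (Set.univ ×ˢ Set.Ici 0)
  contDiffOn : ContDiffOn ℝ ∞ (Function.uncurry X) (Set.univ ×ˢ Set.Ioi 0)
  slice : ∀ t, 0 ≤ t → IsStrictlyConvexCompleteCurve (fun p => X p t)
  flow : ∀ p t, 0 < t →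
    HasDerivAt (fun τ => X p τ)
      (curvature (fun q => X q t) p ^ α • unitNormal (fun q => X q t) p) t

/-- The speed `u = κ ^ α` at time `t`, as a function of the parameter `p`. -/
def speed (α : ℝ) (X : ℝ → ℝ → Plane) (t p : ℝ) : ℝ :=
  curvature (fun q => X q t) p ^ α

/-- The first arc-length derivative `u_s` of the speed at time `t`. -/
def speedS (α : ℝ) (X : ℝ → ℝ → Plane) (t p : ℝ) : ℝ :=
  arcDeriv (fun q => X q t) (speed α X t) p

/-- The second arc-length derivative `u_ss` of the speed at time `t`. -/
def speedSS (α : ℝ) (X : ℝ → ℝ → Plane) (t p : ℝ) : ℝ :=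
  arcDeriv (fun q => X q t) (speedS α X t) p

end

/-!
Bernstein's technique. Fix a weight exponent `γ ≤ min(β, 2β - 1)` and put `η = r² - |X|²`,
`z = u_s u^(-β)`, `W = u_ss u^(-β)`. The maximum principle on a short time interval starting at
`t₁` is applied to

  `η² (u_ss u^(-γ))² (t - t₁) exp (l z²)`, with `l K² < 1`.

At an interior maximum the vanishing first derivative eliminates `u_sss`. The heat operator of the
logarithm then equals `α κ^(α - 1) W²` times a polynomial in `z` and in the ratios to `W` or `W²`
of the lower-order quantities: a power of `u`, the curvature, the derivatives of the cutoff and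
the time weight. When all these ratios vanish the polynomial is `2 l (l z² - 1)`, which is
negative because `|z| ≤ K`. So at least one ratio is bounded below, that is, `W` is controlled by
a lower-order quantity. The condition `β ≤ 1 / α` and the bound on `u` turn this into a bound on
the maximum.
-/

noncomputable section

open Set Filter Topology

section ArcDerivative

variable {F : Type*} [NormedAddCommGroup F] [NormedSpace ℝ F]
variable {γ : ℝ → Plane} {p : ℝ}

theorem arcDeriv_smul {c : ℝ → ℝ} {f : ℝ → F} (hc : DifferentiableAt ℝ c p)
    (hf : DifferentiableAt ℝ f p) :
    arcDeriv γ (c • f) p = arcDeriv γ c p • f p + c p • arcDeriv γ f p := by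
  simp only [arcDeriv, deriv_smul hc hf]
  module

theorem arcDeriv_inner {f h : ℝ → Plane} (hf : DifferentiableAt ℝ f p)
    (hh : DifferentiableAt ℝ h p) :
    arcDeriv γ (fun q => inner ℝ (f q) (h q)) p
      = inner ℝ (f p) (arcDeriv γ h p) + inner ℝ (arcDeriv γ f p) (h p) := by
  simp only [arcDeriv, deriv_inner_apply ℝ hf hh, smul_eq_mul, real_inner_smul_left,
    real_inner_smul_right]
  ring

theorem arcDeriv_comp {Φ f : ℝ → ℝ} {Φ' : ℝ} (hΦ : HasDerivAt Φ Φ' (f p))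
    (hf : DifferentiableAt ℝ f p) : arcDeriv γ (fun q => Φ (f q)) p = Φ' * arcDeriv γ f p := by
  have hcomp : deriv (fun q => Φ (f q)) p = Φ' * deriv f p := (hΦ.comp p hf.hasDerivAt).deriv
  simp only [arcDeriv, hcomp, smul_eq_mul]
  ring

theorem arcDeriv_clm {f : ℝ → F} {G : Type*} [NormedAddCommGroup G] [NormedSpace ℝ G]
    (A : F →L[ℝ] G) (hf : DifferentiableAt ℝ f p) :
    arcDeriv γ (fun q => A (f q)) p = A (arcDeriv γ f p) := by
  have hcomp : deriv (fun q => A (f q)) p = A (deriv f p) :=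
    (A.hasFDerivAt.comp_hasDerivAt p hf.hasDerivAt).deriv
  simp only [arcDeriv, hcomp, map_smul]

end ArcDerivative

section SpaceTime

variable {F : Type*} [NormedAddCommGroup F] [NormedSpace ℝ F]

/-- `f = f(t, p)` is jointly smooth for `t > 0`. Unlike in `IsAlphaCSF`, the time comes first, so
that `f t` is a function on the curve `M_t`. -/
def SmoothPos (f : ℝ → ℝ → F) : Prop :=
  ContDiffOn ℝ ∞ (Function.uncurry f) (Ioi 0 ×ˢ univ)

/-- The partial derivative `∂_t f` with respect to the time, at a fixed parameter. -/
def tDeriv (f : ℝ → ℝ → F) (t p : ℝ) : F := deriv (fun τ => f τ p) t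

/-- The partial derivative `∂_p f` with respect to the parameter. -/
def pDeriv (f : ℝ → ℝ → F) (t p : ℝ) : F := deriv (f t) p

/-- The derivative `∂_s f` with respect to the arc length of the curve `X(·, t)`. -/
def sDeriv (X : ℝ → ℝ → Plane) (f : ℝ → ℝ → F) (t p : ℝ) : F :=
  arcDeriv (fun q => X q t) (f t) p

namespace SmoothPos

variable {f h : ℝ → ℝ → F} {t p : ℝ}

theorem congr (hf : SmoothPos f) (H : ∀ t p, 0 < t → h t p = f t p) : SmoothPos h :=
  ContDiffOn.congr hf fun z hz => H z.1 z.2 hz.1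

theorem contDiffAt (hf : SmoothPos f) (ht : 0 < t) :
    ContDiffAt ℝ ∞ (Function.uncurry f) (t, p) :=
  ContDiffOn.contDiffAt hf (prod_mem_nhds (Ioi_mem_nhds ht) univ_mem)

theorem hasFDerivAt (hf : SmoothPos f) (ht : 0 < t) :
    HasFDerivAt (Function.uncurry f) (fderiv ℝ (Function.uncurry f) (t, p)) (t, p) :=
  ((hf.contDiffAt ht).differentiableAt (by simp)).hasFDerivAt

theorem hasDerivAt_fst (hf : SmoothPos f) (ht : 0 < t) :
    HasDerivAt (fun τ => f τ p) (fderiv ℝ (Function.uncurry f) (t, p) (1, 0)) t :=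
  (hf.hasFDerivAt ht).comp_hasDerivAt (f := fun τ => (τ, p)) t
    ((hasDerivAt_id t).prodMk (hasDerivAt_const t p))

theorem hasDerivAt_snd (hf : SmoothPos f) (ht : 0 < t) :
    HasDerivAt (f t) (fderiv ℝ (Function.uncurry f) (t, p) (0, 1)) p :=
  (hf.hasFDerivAt ht).comp_hasDerivAt (f := fun q => (t, q)) p
    ((hasDerivAt_const p t).prodMk (hasDerivAt_id p))

theorem tDifferentiableAt (hf : SmoothPos f) (ht : 0 < t) :
    DifferentiableAt ℝ (fun τ => f τ p) t := (hf.hasDerivAt_fst ht).differentiableAt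

theorem pDifferentiableAt (hf : SmoothPos f) (ht : 0 < t) : DifferentiableAt ℝ (f t) p :=
  (hf.hasDerivAt_snd ht).differentiableAt

theorem tDeriv_eq_fderiv (hf : SmoothPos f) (ht : 0 < t) :
    tDeriv f t p = fderiv ℝ (Function.uncurry f) (t, p) (1, 0) := (hf.hasDerivAt_fst ht).deriv

theorem pDeriv_eq_fderiv (hf : SmoothPos f) (ht : 0 < t) :
    pDeriv f t p = fderiv ℝ (Function.uncurry f) (t, p) (0, 1) := (hf.hasDerivAt_snd ht).deriv

theorem contDiffOn_fderiv (hf : SmoothPos f) :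
    ContDiffOn ℝ ∞ (fderiv ℝ (Function.uncurry f)) (Ioi 0 ×ˢ univ) :=
  ContDiffOn.fderiv_of_isOpen hf (isOpen_Ioi.prod isOpen_univ) (by simp)

theorem fderiv_apply (hf : SmoothPos f) (v : ℝ × ℝ) :
    SmoothPos fun t p => fderiv ℝ (Function.uncurry f) (t, p) v :=
  hf.contDiffOn_fderiv.clm_apply contDiffOn_const

theorem fderiv_fderiv_apply (hf : SmoothPos f) (ht : 0 < t) (v w : ℝ × ℝ) :
    fderiv ℝ (Function.uncurry fun t p => fderiv ℝ (Function.uncurry f) (t, p) v) (t, p) w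
      = fderiv ℝ (fderiv ℝ (Function.uncurry f)) (t, p) w v := by
  have hd : DifferentiableAt ℝ (fderiv ℝ (Function.uncurry f)) (t, p) :=
    (hf.contDiffOn_fderiv.contDiffAt (prod_mem_nhds (Ioi_mem_nhds ht)
      univ_mem)).differentiableAt (by simp)
  change fderiv ℝ (fun z => fderiv ℝ (Function.uncurry f) z v) (t, p) w = _
  simp [fderiv_clm_apply hd (differentiableAt_const v)]

theorem pDeriv (hf : SmoothPos f) : SmoothPos (pDeriv f) :=
  (hf.fderiv_apply (0, 1)).congr fun _ _ ht => hf.pDeriv_eq_fderiv ht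

theorem tDeriv (hf : SmoothPos f) : SmoothPos (tDeriv f) :=
  (hf.fderiv_apply (1, 0)).congr fun _ _ ht => hf.tDeriv_eq_fderiv ht

end SmoothPos

variable {f h : ℝ → ℝ → F} {t p : ℝ}

theorem tDeriv_congr (H : ∀ t p, 0 < t → f t p = h t p) (ht : 0 < t) :
    tDeriv f t p = tDeriv h t p :=
  EventuallyEq.deriv_eq ((lt_mem_nhds ht).mono fun τ hτ => H τ p hτ)

theorem pDeriv_congr (H : ∀ t p, 0 < t → f t p = h t p) (ht : 0 < t) :
    pDeriv f t p = pDeriv h t p :=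
  congrArg (deriv · p) (funext fun q => H t q ht)

theorem sDeriv_congr {X : ℝ → ℝ → Plane} (H : ∀ t p, 0 < t → f t p = h t p) (ht : 0 < t) :
    sDeriv X f t p = sDeriv X h t p :=
  congrArg (arcDeriv _ · p) (funext fun q => H t q ht)

theorem tDeriv_pDeriv_comm (hf : SmoothPos f) (ht : 0 < t) :
    tDeriv (pDeriv f) t p = pDeriv (tDeriv f) t p := by
  have hsymm : IsSymmSndFDerivAt ℝ (Function.uncurry f) (t, p) :=
    (hf.contDiffAt ht).isSymmSndFDerivAt (by
      rw [minSmoothness_of_isRCLikeNormedField]; exact WithTop.coe_le_coe.2 le_top)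
  rw [tDeriv_congr (fun _ _ => hf.pDeriv_eq_fderiv) ht,
    pDeriv_congr (fun _ _ => hf.tDeriv_eq_fderiv) ht, (hf.fderiv_apply _).tDeriv_eq_fderiv ht,
    (hf.fderiv_apply _).pDeriv_eq_fderiv ht, hf.fderiv_fderiv_apply ht,
    hf.fderiv_fderiv_apply ht, hsymm.eq]

end SpaceTime

section ProductAndChainRules

variable {F : Type*} [NormedAddCommGroup F] [NormedSpace ℝ F]
variable {f h : ℝ → ℝ → ℝ} {t p : ℝ}

namespace SmoothPos

theorem mul (hf : SmoothPos f) (hh : SmoothPos h) : SmoothPos (f * h) :=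
  ContDiffOn.mul hf hh

theorem inner {f h : ℝ → ℝ → Plane} (hf : SmoothPos f) (hh : SmoothPos h) :
    SmoothPos fun t p => inner ℝ (f t p) (h t p) :=
  ContDiffOn.inner ℝ hf hh

theorem exp (hf : SmoothPos f) : SmoothPos fun t p => Real.exp (f t p) :=
  ContDiffOn.exp hf

theorem rpow (hf : SmoothPos f) (h0 : ∀ t p, 0 < t → f t p ≠ 0) (b : ℝ) :
    SmoothPos fun t p => f t p ^ b :=
  ContDiffOn.rpow_const_of_ne hf fun z hz => h0 z.1 z.2 hz.1

end SmoothPos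

theorem tDeriv_smul {g : ℝ → ℝ → F} (hf : SmoothPos f) (hg : SmoothPos g) (ht : 0 < t) :
    tDeriv (f • g) t p = f t p • tDeriv g t p + tDeriv f t p • g t p :=
  deriv_fun_smul (hf.tDifferentiableAt ht) (hg.tDifferentiableAt ht)

theorem tDeriv_mul (hf : SmoothPos f) (hh : SmoothPos h) (ht : 0 < t) :
    tDeriv (f * h) t p = tDeriv f t p * h t p + f t p * tDeriv h t p :=
  deriv_fun_mul (hf.tDifferentiableAt ht) (hh.tDifferentiableAt ht)

theorem tDeriv_inner {f h : ℝ → ℝ → Plane} (hf : SmoothPos f) (hh : SmoothPos h) (ht : 0 < t) :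
    tDeriv (fun t p => inner ℝ (f t p) (h t p)) t p
      = inner ℝ (f t p) (tDeriv h t p) + inner ℝ (tDeriv f t p) (h t p) :=
  deriv_inner_apply ℝ (hf.tDifferentiableAt ht) (hh.tDifferentiableAt ht)

theorem sDeriv_mul {X : ℝ → ℝ → Plane} (hf : SmoothPos f) (hh : SmoothPos h) (ht : 0 < t) :
    sDeriv X (f * h) t p = sDeriv X f t p * h t p + f t p * sDeriv X h t p :=
  arcDeriv_smul (hf.pDifferentiableAt ht) (hh.pDifferentiableAt ht)

theorem sDeriv_comp {X : ℝ → ℝ → Plane} {Φ : ℝ → ℝ} {Φ' : ℝ} (hΦ : HasDerivAt Φ Φ' (f t p))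
    (hf : SmoothPos f) (ht : 0 < t) :
    sDeriv X (fun t p => Φ (f t p)) t p = Φ' * sDeriv X f t p :=
  arcDeriv_comp hΦ (hf.pDifferentiableAt ht)

theorem tDeriv_comp {Φ : ℝ → ℝ} {Φ' : ℝ} (hΦ : HasDerivAt Φ Φ' (f t p)) (hf : SmoothPos f)
    (ht : 0 < t) : tDeriv (fun t p => Φ (f t p)) t p = Φ' * tDeriv f t p :=
  (hΦ.comp t (hf.tDifferentiableAt ht).hasDerivAt).deriv

end ProductAndChainRules

section Frenet

/-- `rotate` as a continuous linear map. -/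
def rotateCLM : Plane →L[ℝ] Plane :=
  LinearMap.toContinuousLinearMap
    { toFun := rotate
      map_add' := fun v w => by ext i; fin_cases i <;> simp [rotate, add_comm]
      map_smul' := fun c v => by ext i; fin_cases i <;> simp [rotate] }

theorem inner_plane (v w : Plane) : inner ℝ v w = v 0 * w 0 + v 1 * w 1 := by
  simp [PiLp.inner_apply, Fin.sum_univ_two, mul_comm]

theorem inner_rotate_self (v : Plane) : inner ℝ (rotate v) v = 0 := by
  simp only [inner_plane, rotate, Matrix.cons_val_zero, Matrix.cons_val_one]
  ring

theorem inner_rotate_rotate (v w : Plane) : inner ℝ (rotate v) (rotate w) = inner ℝ v w := by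
  simp only [inner_plane, rotate, Matrix.cons_val_zero, Matrix.cons_val_one]
  ring

theorem rotate_rotate (v : Plane) : rotate (rotate v) = -v := by
  ext i; fin_cases i <;> simp [rotate]

theorem eq_inner_smul_add_inner_rotate_smul {T : Plane} (hT : inner ℝ T T = 1) (v : Plane) :
    v = inner ℝ v T • T + inner ℝ v (rotate T) • rotate T := by
  rw [inner_plane] at hT
  ext i
  fin_cases i <;>
    simp only [inner_plane, rotate, Fin.mk_zero, Fin.mk_one, Fin.isValue, PiLp.add_apply,
      PiLp.smul_apply, Matrix.cons_val_zero, Matrix.cons_val_one, smul_eq_mul]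
  · linear_combination -(v 0) * hT
  · linear_combination -(v 1) * hT

variable {γ : ℝ → Plane} {p : ℝ}

theorem inner_unitTangent_self (hp : deriv γ p ≠ 0) :
    inner ℝ (unitTangent γ p) (unitTangent γ p) = 1 := by
  rw [real_inner_self_eq_norm_sq, unitTangent, arcDeriv, norm_smul, norm_inv, norm_norm,
    inv_mul_cancel₀ (norm_ne_zero_iff.2 hp), one_pow]

theorem arcDeriv_unitTangent (himm : ∀ q, deriv γ q ≠ 0)
    (hd : DifferentiableAt ℝ (unitTangent γ) p) :
    arcDeriv γ (unitTangent γ) p = curvature γ p • unitNormal γ p := by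
  have horth : inner ℝ (arcDeriv γ (unitTangent γ) p) (unitTangent γ p) = 0 := by
    have hconst : (fun q => inner ℝ (unitTangent γ q) (unitTangent γ q)) = fun _ => (1 : ℝ) :=
      funext fun q => inner_unitTangent_self (himm q)
    have h := arcDeriv_inner (γ := γ) hd hd
    rw [hconst, real_inner_comm] at h
    simp only [arcDeriv, deriv_const, smul_zero] at h ⊢
    linarith
  calc arcDeriv γ (unitTangent γ) p
      = _ • unitTangent γ p + curvature γ p • unitNormal γ p :=
        eq_inner_smul_add_inner_rotate_smul (inner_unitTangent_self (himm p)) _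
    _ = curvature γ p • unitNormal γ p := by rw [horth, zero_smul, zero_add]

theorem arcDeriv_unitNormal (himm : ∀ q, deriv γ q ≠ 0)
    (hd : DifferentiableAt ℝ (unitTangent γ) p) :
    arcDeriv γ (unitNormal γ) p = -(curvature γ p • unitTangent γ p) :=
  calc arcDeriv γ (unitNormal γ) p
      = rotateCLM (arcDeriv γ (unitTangent γ) p) := arcDeriv_clm rotateCLM hd
    _ = curvature γ p • rotate (unitNormal γ p) := by
        rw [arcDeriv_unitTangent himm hd, map_smul]; rfl
    _ = -(curvature γ p • unitTangent γ p) := by rw [unitNormal, rotate_rotate, smul_neg]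

end Frenet

section FlowGeometry

/-- The position vector `X`, with the time as its first argument. -/
def position (X : ℝ → ℝ → Plane) (t p : ℝ) : Plane := X p t

/-- The unit tangent vector of the curve `X(·, t)`. -/
def tangent (X : ℝ → ℝ → Plane) (t p : ℝ) : Plane := unitTangent (fun q => X q t) p

/-- The unit normal vector of the curve `X(·, t)`. -/
def normal (X : ℝ → ℝ → Plane) (t p : ℝ) : Plane := unitNormal (fun q => X q t) p

/-- The curvature `κ` of the curve `X(·, t)`. -/
def curv (X : ℝ → ℝ → Plane) (t p : ℝ) : ℝ := curvature (fun q => X q t) p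

/-- The length element `|∂_p X|`. -/
def lengthElement (X : ℝ → ℝ → Plane) (t p : ℝ) : ℝ := ‖deriv (fun q => X q t) p‖

theorem sDeriv_speed (α : ℝ) (X : ℝ → ℝ → Plane) : sDeriv X (speed α X) = speedS α X := rfl

theorem sDeriv_speedS (α : ℝ) (X : ℝ → ℝ → Plane) : sDeriv X (speedS α X) = speedSS α X := rfl

namespace IsAlphaCSF

variable {F : Type*} [NormedAddCommGroup F] [NormedSpace ℝ F]
variable {α : ℝ} {X : ℝ → ℝ → Plane} {f : ℝ → ℝ → F} {t p : ℝ}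

theorem immersion (hX : IsAlphaCSF α X) (ht : 0 < t) (p : ℝ) : deriv (fun q => X q t) p ≠ 0 :=
  (hX.slice t ht.le).immersion p

theorem lengthElement_ne_zero (hX : IsAlphaCSF α X) (ht : 0 < t) : lengthElement X t p ≠ 0 :=
  norm_ne_zero_iff.2 (hX.immersion ht p)

theorem curv_pos (hX : IsAlphaCSF α X) (ht : 0 < t) : 0 < curv X t p :=
  (hX.slice t ht.le).curvature_pos p

theorem speed_pos (hX : IsAlphaCSF α X) (ht : 0 < t) : 0 < speed α X t p :=
  Real.rpow_pos_of_pos (hX.curv_pos ht) α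

theorem smooth_position (hX : IsAlphaCSF α X) : SmoothPos (position X) :=
  hX.contDiffOn.comp (contDiff_snd.prodMk contDiff_fst).contDiffOn fun _ hz => ⟨trivial, hz.1⟩

theorem smooth_lengthElement (hX : IsAlphaCSF α X) : SmoothPos (lengthElement X) :=
  ContDiffOn.norm ℝ hX.smooth_position.pDeriv fun z hz => hX.immersion hz.1 z.2

theorem smooth_sDeriv (hX : IsAlphaCSF α X) (hf : SmoothPos f) : SmoothPos (sDeriv X f) :=
  (ContDiffOn.inv hX.smooth_lengthElement fun _ hz => hX.lengthElement_ne_zero hz.1).smul hf.pDeriv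

theorem smooth_tangent (hX : IsAlphaCSF α X) : SmoothPos (tangent X) :=
  hX.smooth_sDeriv hX.smooth_position

theorem smooth_normal (hX : IsAlphaCSF α X) : SmoothPos (normal X) :=
  rotateCLM.contDiff.comp_contDiffOn hX.smooth_tangent

theorem smooth_curv (hX : IsAlphaCSF α X) : SmoothPos (curv X) :=
  (hX.smooth_sDeriv hX.smooth_tangent).inner hX.smooth_normal

theorem smooth_speed (hX : IsAlphaCSF α X) : SmoothPos (speed α X) :=
  hX.smooth_curv.rpow (fun _ _ ht => (hX.curv_pos ht).ne') α

theorem smooth_speedS (hX : IsAlphaCSF α X) : SmoothPos (speedS α X) :=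
  hX.smooth_sDeriv hX.smooth_speed

theorem smooth_speedSS (hX : IsAlphaCSF α X) : SmoothPos (speedSS α X) :=
  hX.smooth_sDeriv hX.smooth_speedS

theorem sDeriv_tangent (hX : IsAlphaCSF α X) (ht : 0 < t) :
    sDeriv X (tangent X) t p = curv X t p • normal X t p :=
  arcDeriv_unitTangent (hX.immersion ht) (hX.smooth_tangent.pDifferentiableAt ht)

theorem sDeriv_normal (hX : IsAlphaCSF α X) (ht : 0 < t) :
    sDeriv X (normal X) t p = -(curv X t p • tangent X t p) :=
  arcDeriv_unitNormal (hX.immersion ht) (hX.smooth_tangent.pDifferentiableAt ht)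

theorem inner_tangent_self (hX : IsAlphaCSF α X) (ht : 0 < t) :
    inner ℝ (tangent X t p) (tangent X t p) = 1 :=
  inner_unitTangent_self (hX.immersion ht p)

theorem inner_normal_self (hX : IsAlphaCSF α X) (ht : 0 < t) :
    inner ℝ (normal X t p) (normal X t p) = 1 :=
  (inner_rotate_rotate _ _).trans (hX.inner_tangent_self ht)

theorem norm_tangent (hX : IsAlphaCSF α X) (ht : 0 < t) : ‖tangent X t p‖ = 1 := by
  rw [@norm_eq_sqrt_real_inner, hX.inner_tangent_self ht, Real.sqrt_one]

theorem norm_normal (hX : IsAlphaCSF α X) (ht : 0 < t) : ‖normal X t p‖ = 1 := by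
  rw [@norm_eq_sqrt_real_inner, hX.inner_normal_self ht, Real.sqrt_one]

theorem tDeriv_position (hX : IsAlphaCSF α X) (ht : 0 < t) :
    tDeriv (position X) t p = speed α X t p • normal X t p :=
  (hX.flow p t ht).deriv

theorem sDeriv_smul_normal (hX : IsAlphaCSF α X) {c : ℝ → ℝ → ℝ} (hc : SmoothPos c)
    (ht : 0 < t) :
    sDeriv X (c • normal X) t p
      = sDeriv X c t p • normal X t p - (curv X t p * c t p) • tangent X t p := by
  have hN := hX.sDeriv_normal (p := p) ht
  have hprod : sDeriv X (c • normal X) t p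
      = sDeriv X c t p • normal X t p + c t p • sDeriv X (normal X) t p :=
    arcDeriv_smul (hc.pDifferentiableAt ht) (hX.smooth_normal.pDifferentiableAt ht)
  rw [hprod, hN]
  module

theorem pDeriv_eq_smul_sDeriv (hX : IsAlphaCSF α X) (ht : 0 < t) (f : ℝ → ℝ → F) :
    pDeriv f t p = lengthElement X t p • sDeriv X f t p :=
  (smul_inv_smul₀ (hX.lengthElement_ne_zero ht) _).symm

theorem tDeriv_lengthElement (hX : IsAlphaCSF α X) (ht : 0 < t) :
    tDeriv (lengthElement X) t p
      = -(curv X t p * speed α X t p) * lengthElement X t p := by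
  have hsq : ∀ t p, lengthElement X t p * lengthElement X t p
      = inner ℝ (pDeriv (position X) t p) (pDeriv (position X) t p) := fun t p =>
    (real_inner_self_eq_norm_mul_norm _).symm
  have hX' := hX.smooth_position.pDeriv
  have hvel : pDeriv (tDeriv (position X)) t p = lengthElement X t p • sDeriv X
      (speed α X • normal X) t p := by
    rw [pDeriv_congr (fun _ _ => hX.tDeriv_position) ht]
    exact hX.pDeriv_eq_smul_sDeriv ht (speed α X • normal X)
  have hder : tDeriv (lengthElement X) t p * lengthElement X t p
      + lengthElement X t p * tDeriv (lengthElement X) t p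
      = 2 * (-(curv X t p * speed α X t p) * lengthElement X t p) * lengthElement X t p := by
    rw [← tDeriv_mul hX.smooth_lengthElement hX.smooth_lengthElement ht,
      tDeriv_congr (f := lengthElement X * lengthElement X) (fun t p _ => hsq t p) ht,
      tDeriv_inner hX' hX' ht, tDeriv_pDeriv_comm hX.smooth_position ht, hvel,
      hX.sDeriv_smul_normal hX.smooth_speed ht, hX.pDeriv_eq_smul_sDeriv ht]
    change inner ℝ (_ • tangent X t p) _ + inner ℝ _ (_ • tangent X t p) = _
    have hNT : inner ℝ (normal X t p) (tangent X t p) = 0 := inner_rotate_self _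
    simp only [inner_sub_left, inner_sub_right, real_inner_smul_left, real_inner_smul_right,
      hX.inner_tangent_self ht, hNT, real_inner_comm (normal X t p) (tangent X t p)]
    ring
  have := hX.lengthElement_ne_zero (p := p) ht
  exact mul_right_cancel₀ this (by linarith)

theorem tDeriv_sDeriv (hX : IsAlphaCSF α X) (hf : SmoothPos f) (ht : 0 < t) :
    tDeriv (sDeriv X f) t p
      = sDeriv X (tDeriv f) t p + (curv X t p * speed α X t p) • sDeriv X f t p := by
  have hg := hX.lengthElement_ne_zero (p := p) ht
  have hprod : tDeriv (pDeriv f) t p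
      = lengthElement X t p • tDeriv (sDeriv X f) t p
        + tDeriv (lengthElement X) t p • sDeriv X f t p := by
    rw [← tDeriv_smul hX.smooth_lengthElement (hX.smooth_sDeriv hf) ht]
    exact tDeriv_congr (fun _ _ ht => hX.pDeriv_eq_smul_sDeriv ht f) ht
  rw [tDeriv_pDeriv_comm hf ht, hX.pDeriv_eq_smul_sDeriv ht, hX.tDeriv_lengthElement ht] at hprod
  refine smul_right_injective F hg ?_
  simp only [smul_add, hprod]
  module

theorem tDeriv_tangent (hX : IsAlphaCSF α X) (ht : 0 < t) :
    tDeriv (tangent X) t p = speedS α X t p • normal X t p :=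
  calc tDeriv (sDeriv X (position X)) t p
      = sDeriv X (tDeriv (position X)) t p + (curv X t p * speed α X t p) • tangent X t p :=
        hX.tDeriv_sDeriv hX.smooth_position ht
    _ = sDeriv X (speed α X • normal X) t p + (curv X t p * speed α X t p) • tangent X t p := by
        rw [sDeriv_congr (h := speed α X • normal X) (fun _ _ => hX.tDeriv_position) ht]
    _ = speedS α X t p • normal X t p := by
        rw [hX.sDeriv_smul_normal hX.smooth_speed ht, sub_add_cancel, sDeriv_speed]

theorem tDeriv_normal (hX : IsAlphaCSF α X) (ht : 0 < t) :
    tDeriv (normal X) t p = -(speedS α X t p • tangent X t p) :=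
  calc tDeriv (fun t p => rotateCLM (tangent X t p)) t p
      = rotateCLM (tDeriv (tangent X) t p) :=
        (rotateCLM.hasFDerivAt.comp_hasDerivAt t
          (hX.smooth_tangent.tDifferentiableAt ht).hasDerivAt).deriv
    _ = speedS α X t p • rotate (rotate (tangent X t p)) := by
        rw [hX.tDeriv_tangent ht, map_smul]; rfl
    _ = -(speedS α X t p • tangent X t p) := by rw [rotate_rotate, smul_neg]

theorem tDeriv_curv (hX : IsAlphaCSF α X) (ht : 0 < t) :
    tDeriv (curv X) t p = speedSS α X t p + curv X t p ^ 2 * speed α X t p := by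
  have hTs : tDeriv (sDeriv X (tangent X)) t p
      = speedSS α X t p • normal X t p - (curv X t p * speedS α X t p) • tangent X t p
        + (curv X t p * speed α X t p) • curv X t p • normal X t p := by
    rw [hX.tDeriv_sDeriv hX.smooth_tangent ht, hX.sDeriv_tangent ht,
      sDeriv_congr (h := speedS α X • normal X) (fun _ _ => hX.tDeriv_tangent) ht,
      hX.sDeriv_smul_normal hX.smooth_speedS ht, sDeriv_speedS]
  have hNT : inner ℝ (normal X t p) (tangent X t p) = 0 := inner_rotate_self _
  calc tDeriv (fun t p => inner ℝ (sDeriv X (tangent X) t p) (normal X t p)) t p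
      = inner ℝ (sDeriv X (tangent X) t p) (tDeriv (normal X) t p)
        + inner ℝ (tDeriv (sDeriv X (tangent X)) t p) (normal X t p) :=
        tDeriv_inner (hX.smooth_sDeriv hX.smooth_tangent) hX.smooth_normal ht
    _ = speedSS α X t p + curv X t p ^ 2 * speed α X t p := by
        rw [hTs, hX.tDeriv_normal ht, hX.sDeriv_tangent ht]
        simp only [inner_add_left, inner_sub_left, inner_neg_right, real_inner_smul_left,
          real_inner_smul_right, hX.inner_normal_self ht, hNT,
          real_inner_comm (normal X t p) (tangent X t p)]
        ring

end IsAlphaCSF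

end FlowGeometry

section HeatOperator

/-- The heat operator `∂_t f - a ∂_s ∂_s f` with diffusivity `a` along the curves `X(·, t)`. -/
def heat (X : ℝ → ℝ → Plane) (a f : ℝ → ℝ → ℝ) (t p : ℝ) : ℝ :=
  tDeriv f t p - a t p * sDeriv X (sDeriv X f) t p

/-- The arc-length derivative of `log f`, written without the logarithm. -/
def logSDeriv (X : ℝ → ℝ → Plane) (f : ℝ → ℝ → ℝ) (t p : ℝ) : ℝ := sDeriv X f t p / f t p

/-- The value of the heat operator at `log f`, written without the logarithm. -/
def logHeat (X : ℝ → ℝ → Plane) (a f : ℝ → ℝ → ℝ) (t p : ℝ) : ℝ :=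
  heat X a f t p / f t p + a t p * logSDeriv X f t p ^ 2

theorem logSDeriv_mul {X : ℝ → ℝ → Plane} {f h : ℝ → ℝ → ℝ} {t p : ℝ} (hf : SmoothPos f)
    (hh : SmoothPos h) (ht : 0 < t) (hf0 : f t p ≠ 0) (hh0 : h t p ≠ 0) :
    logSDeriv X (f * h) t p = logSDeriv X f t p + logSDeriv X h t p := by
  rw [logSDeriv, logSDeriv, logSDeriv, sDeriv_mul hf hh ht, Pi.mul_apply, Pi.mul_apply]
  field_simp

theorem logSDeriv_exp {X : ℝ → ℝ → Plane} {f : ℝ → ℝ → ℝ} {t p : ℝ} (hf : SmoothPos f)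
    (ht : 0 < t) : logSDeriv X (fun t p => Real.exp (f t p)) t p = sDeriv X f t p := by
  rw [logSDeriv, sDeriv_comp (Real.hasDerivAt_exp _) hf ht,
    mul_div_cancel_left₀ _ (Real.exp_ne_zero _)]

theorem logSDeriv_rpow {X : ℝ → ℝ → Plane} {f : ℝ → ℝ → ℝ} {t p : ℝ} (hf : SmoothPos f)
    (hf0 : 0 < f t p) (b : ℝ) (ht : 0 < t) :
    logSDeriv X (fun t p => f t p ^ b) t p = b * logSDeriv X f t p := by
  rw [logSDeriv, logSDeriv, sDeriv_comp (Real.hasDerivAt_rpow_const (.inl hf0.ne')) hf ht,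
    Real.rpow_sub_one hf0.ne']
  field_simp

namespace IsAlphaCSF

variable {α : ℝ} {X : ℝ → ℝ → Plane} {a f h : ℝ → ℝ → ℝ} {t p : ℝ}

theorem hasDerivAt_slice (hX : IsAlphaCSF α X) (hf : SmoothPos f) (ht : 0 < t) :
    HasDerivAt (f t) (lengthElement X t p * sDeriv X f t p) p := by
  have := (hf.pDifferentiableAt (p := p) ht).hasDerivAt
  rwa [show deriv (f t) p = _ from hX.pDeriv_eq_smul_sDeriv ht f] at this

theorem sDeriv_eq_of_hasDerivAt (hX : IsAlphaCSF α X) (ht : 0 < t) {c : ℝ}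
    (hf : HasDerivAt (f t) (lengthElement X t p * c) p) : sDeriv X f t p = c := by
  have := hX.pDeriv_eq_smul_sDeriv (p := p) ht f
  exact mul_left_cancel₀ (hX.lengthElement_ne_zero ht) (this.symm.trans hf.deriv)

theorem heat_mul (hX : IsAlphaCSF α X) (hf : SmoothPos f) (hh : SmoothPos h) (ht : 0 < t) :
    heat X a (f * h) t p = heat X a f t p * h t p + f t p * heat X a h t p
      - 2 * a t p * sDeriv X f t p * sDeriv X h t p := by
  have hfs := hX.smooth_sDeriv hf
  have hhs := hX.smooth_sDeriv hh
  have hss : sDeriv X (sDeriv X (f * h)) t p = sDeriv X (sDeriv X f) t p * h t p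
      + 2 * sDeriv X f t p * sDeriv X h t p + f t p * sDeriv X (sDeriv X h) t p := by
    rw [sDeriv_congr (h := sDeriv X f * h + f * sDeriv X h) (fun _ _ => sDeriv_mul hf hh) ht]
    refine hX.sDeriv_eq_of_hasDerivAt ht ((((hX.hasDerivAt_slice hfs ht).mul
      (hX.hasDerivAt_slice hh ht)).add ((hX.hasDerivAt_slice hf ht).mul
      (hX.hasDerivAt_slice hhs ht))).congr_deriv ?_)
    ring
  rw [heat, heat, heat, tDeriv_mul hf hh ht, hss]
  ring

theorem heat_comp (hX : IsAlphaCSF α X) {Φ Φ' Φ'' : ℝ → ℝ} (hf : SmoothPos f)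
    (hΦ : ∀ t p, 0 < t → HasDerivAt Φ (Φ' (f t p)) (f t p))
    (hΦ' : ∀ t p, 0 < t → HasDerivAt Φ' (Φ'' (f t p)) (f t p)) (ht : 0 < t) :
    heat X a (fun t p => Φ (f t p)) t p
      = Φ' (f t p) * heat X a f t p - a t p * Φ'' (f t p) * sDeriv X f t p ^ 2 := by
  have hfs := hX.smooth_sDeriv hf
  have hss : sDeriv X (sDeriv X fun t p => Φ (f t p)) t p
      = Φ'' (f t p) * sDeriv X f t p ^ 2 + Φ' (f t p) * sDeriv X (sDeriv X f) t p := by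
    rw [sDeriv_congr (h := fun t p => Φ' (f t p) * sDeriv X f t p) (fun t p ht =>
      sDeriv_comp (hΦ t p ht) hf ht) ht]
    refine hX.sDeriv_eq_of_hasDerivAt ht ((((hΦ' t p ht).comp p
      (hX.hasDerivAt_slice hf ht)).mul (hX.hasDerivAt_slice hfs ht)).congr_deriv ?_)
    simp only [Function.comp_apply]
    ring
  rw [heat, heat, tDeriv_comp (hΦ t p ht) hf ht, hss]
  ring

theorem heat_sDeriv (hX : IsAlphaCSF α X) (ha : SmoothPos a) (hf : SmoothPos f)
    (ht : 0 < t) :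
    heat X a (sDeriv X f) t p
      = sDeriv X (heat X a f) t p + sDeriv X a t p * sDeriv X (sDeriv X f) t p
        + curv X t p * speed α X t p * sDeriv X f t p := by
  have hfss := hX.smooth_sDeriv (hX.smooth_sDeriv hf)
  have hheat : sDeriv X (heat X a f) t p
      = sDeriv X (tDeriv f) t p - (sDeriv X a t p * sDeriv X (sDeriv X f) t p
        + a t p * sDeriv X (sDeriv X (sDeriv X f)) t p) := by
    refine hX.sDeriv_eq_of_hasDerivAt ht (((hX.hasDerivAt_slice hf.tDeriv ht).sub
      ((hX.hasDerivAt_slice ha ht).mul (hX.hasDerivAt_slice hfss ht))).congr_deriv ?_)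
    ring
  rw [heat, hX.tDeriv_sDeriv hf ht, hheat, smul_eq_mul]
  ring

theorem logHeat_mul (hX : IsAlphaCSF α X) (hf : SmoothPos f) (hh : SmoothPos h) (ht : 0 < t)
    (hf0 : f t p ≠ 0) (hh0 : h t p ≠ 0) :
    logHeat X a (f * h) t p = logHeat X a f t p + logHeat X a h t p := by
  rw [logHeat, logHeat, logHeat, logSDeriv_mul hf hh ht hf0 hh0, hX.heat_mul hf hh ht,
    Pi.mul_apply, Pi.mul_apply, logSDeriv, logSDeriv]
  field_simp
  ring

theorem logHeat_exp (hX : IsAlphaCSF α X) (hf : SmoothPos f) (ht : 0 < t) :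
    logHeat X a (fun t p => Real.exp (f t p)) t p = heat X a f t p := by
  rw [logHeat, logSDeriv_exp hf ht, hX.heat_comp hf (fun _ _ _ => Real.hasDerivAt_exp _)
    (fun _ _ _ => Real.hasDerivAt_exp _) ht]
  field_simp
  ring

theorem logHeat_rpow (hX : IsAlphaCSF α X) (hf : SmoothPos f) (hf0 : ∀ t p, 0 < t → 0 < f t p)
    (b : ℝ) (ht : 0 < t) :
    logHeat X a (fun t p => f t p ^ b) t p = b * logHeat X a f t p := by
  have hpow : ∀ b t p, 0 < t → HasDerivAt (fun x => x ^ b) (b * f t p ^ (b - 1)) (f t p) :=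
    fun b t p ht => Real.hasDerivAt_rpow_const (.inl (hf0 t p ht).ne')
  have hheat : heat X a (fun t p => f t p ^ b) t p = b * f t p ^ (b - 1) * heat X a f t p
      - a t p * (b * ((b - 1) * f t p ^ (b - 1 - 1))) * sDeriv X f t p ^ 2 :=
    hX.heat_comp (Φ := fun x => x ^ b) (Φ' := fun x => b * x ^ (b - 1))
      (Φ'' := fun x => b * ((b - 1) * x ^ (b - 1 - 1))) hf (hpow b)
      (fun t p ht => (hpow (b - 1) t p ht).const_mul b) ht
  have hx := hf0 t p ht
  rw [logHeat, logHeat, logSDeriv_rpow hf hx b ht, hheat, logSDeriv]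
  simp only [Real.rpow_sub_one hx.ne']
  field_simp
  ring

end IsAlphaCSF

end HeatOperator

section Evolution

/-- The diffusivity `a = α κ ^ (α - 1)` of the evolution equation of the speed. -/
def diffusivity (α : ℝ) (X : ℝ → ℝ → Plane) (t p : ℝ) : ℝ := α * speed α X t p / curv X t p

namespace IsAlphaCSF

variable {α : ℝ} {X : ℝ → ℝ → Plane} {t p : ℝ}

theorem smooth_diffusivity (hX : IsAlphaCSF α X) : SmoothPos (diffusivity α X) :=
  ContDiffOn.div (contDiffOn_const.mul hX.smooth_speed) hX.smooth_curv
    fun _ hz => (hX.curv_pos hz.1).ne'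

theorem diffusivity_pos (hX : IsAlphaCSF α X) (hα : 0 < α) (ht : 0 < t) :
    0 < diffusivity α X t p :=
  div_pos (mul_pos hα (hX.speed_pos ht)) (hX.curv_pos ht)

theorem hasDerivAt_rpow_curv (hX : IsAlphaCSF α X) (ht : 0 < t) :
    HasDerivAt (fun x : ℝ => x ^ α) (diffusivity α X t p) (curv X t p) := by
  have hκ := (hX.curv_pos (p := p) ht).ne'
  refine (Real.hasDerivAt_rpow_const (.inl hκ)).congr_deriv ?_
  rw [Real.rpow_sub_one hκ, ← mul_div_assoc]
  rfl

theorem sDeriv_curv (hX : IsAlphaCSF α X) (hα : 0 < α) (ht : 0 < t) :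
    sDeriv X (curv X) t p = speedS α X t p / diffusivity α X t p :=
  eq_div_of_mul_eq (hX.diffusivity_pos hα ht).ne' <| (mul_comm _ _).trans
    (sDeriv_comp (hX.hasDerivAt_rpow_curv ht) hX.smooth_curv ht).symm

theorem sDeriv_diffusivity (hX : IsAlphaCSF α X) (hα : 0 < α) (ht : 0 < t) :
    sDeriv X (diffusivity α X) t p = (α - 1) * speedS α X t p / curv X t p := by
  have hκ := (hX.curv_pos (p := p) ht).ne'
  have hu := (hX.speed_pos (p := p) ht).ne'
  refine hX.sDeriv_eq_of_hasDerivAt ht ((((hX.hasDerivAt_slice hX.smooth_speed ht).const_mul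
    α).div (hX.hasDerivAt_slice hX.smooth_curv ht) hκ).congr_deriv ?_)
  rw [hX.sDeriv_curv hα ht, diffusivity, sDeriv_speed]
  field_simp

theorem heat_speed (hX : IsAlphaCSF α X) (ht : 0 < t) :
    heat X (diffusivity α X) (speed α X) t p
      = diffusivity α X t p * curv X t p ^ 2 * speed α X t p := by
  have htime : tDeriv (speed α X) t p = diffusivity α X t p * tDeriv (curv X) t p :=
    tDeriv_comp (hX.hasDerivAt_rpow_curv ht) hX.smooth_curv ht
  rw [heat, htime, hX.tDeriv_curv ht, sDeriv_speed, sDeriv_speedS]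
  ring

theorem heat_speedS (hX : IsAlphaCSF α X) (hα : 0 < α) (ht : 0 < t) :
    heat X (diffusivity α X) (speedS α X) t p
      = diffusivity α X t p * ((2 + 2 * α⁻¹) * curv X t p ^ 2 * speedS α X t p
        + (1 - α⁻¹) * speedS α X t p * speedSS α X t p / speed α X t p) := by
  have hκ := (hX.curv_pos (p := p) ht).ne'
  have hu := (hX.speed_pos (p := p) ht).ne'
  have ha := hX.smooth_diffusivity
  have hheat : sDeriv X (heat X (diffusivity α X) (speed α X)) t p
      = sDeriv X (diffusivity α X) t p * curv X t p ^ 2 * speed α X t p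
        + diffusivity α X t p * (2 * curv X t p * sDeriv X (curv X) t p * speed α X t p
          + curv X t p ^ 2 * speedS α X t p) := by
    rw [sDeriv_congr (fun _ _ => hX.heat_speed) ht]
    refine hX.sDeriv_eq_of_hasDerivAt ht ((((hX.hasDerivAt_slice ha ht).mul
      ((hX.hasDerivAt_slice hX.smooth_curv ht).pow 2)).mul
      (hX.hasDerivAt_slice hX.smooth_speed ht)).congr_deriv ?_)
    rw [sDeriv_speed, Pi.mul_apply, Pi.pow_apply]
    ring
  rw [← sDeriv_speed, hX.heat_sDeriv ha hX.smooth_speed ht, hheat, hX.sDeriv_curv hα ht,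
    hX.sDeriv_diffusivity hα ht, sDeriv_speed, sDeriv_speedS, diffusivity]
  field_simp
  ring

theorem heat_speedSS (hX : IsAlphaCSF α X) (hα : 0 < α) (ht : 0 < t) :
    heat X (diffusivity α X) (speedSS α X) t p
      = diffusivity α X t p * (
        2 * (1 - α⁻¹) * speedS α X t p * sDeriv X (speedSS α X) t p / speed α X t p
        + (1 - α⁻¹) * speedSS α X t p ^ 2 / speed α X t p
        - α⁻¹ * (1 - α⁻¹) * speedS α X t p ^ 2 * speedSS α X t p / speed α X t p ^ 2
        + (2 + 3 * α⁻¹) * curv X t p ^ 2 * speedSS α X t p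
        + (2 + 2 * α⁻¹) * (1 + α⁻¹) * curv X t p ^ 2 * speedS α X t p ^ 2 / speed α X t p) := by
  have hκ := (hX.curv_pos (p := p) ht).ne'
  have hu := (hX.speed_pos (p := p) ht).ne'
  have ha := hX.smooth_diffusivity
  have hv := hX.hasDerivAt_slice hX.smooth_speedS ht (p := p)
  have hheat : sDeriv X (heat X (diffusivity α X) (speedS α X)) t p
      = sDeriv X (diffusivity α X) t p * ((2 + 2 * α⁻¹) * curv X t p ^ 2 * speedS α X t p
        + (1 - α⁻¹) * speedS α X t p * speedSS α X t p / speed α X t p)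
        + diffusivity α X t p * ((2 + 2 * α⁻¹) * (2 * curv X t p * sDeriv X (curv X) t p
          * speedS α X t p + curv X t p ^ 2 * speedSS α X t p)
        + (1 - α⁻¹) * ((speedSS α X t p ^ 2 + speedS α X t p * sDeriv X (speedSS α X) t p)
          / speed α X t p - speedS α X t p ^ 2 * speedSS α X t p / speed α X t p ^ 2)) := by
    rw [sDeriv_congr (fun _ _ => hX.heat_speedS hα) ht]
    refine hX.sDeriv_eq_of_hasDerivAt ht (((hX.hasDerivAt_slice ha ht).mul
      (((((hX.hasDerivAt_slice hX.smooth_curv ht).pow 2).const_mul (2 + 2 * α⁻¹)).mul hv).add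
      (((hv.const_mul (1 - α⁻¹)).mul (hX.hasDerivAt_slice hX.smooth_speedSS ht)).div
      (hX.hasDerivAt_slice hX.smooth_speed ht) hu))).congr_deriv ?_)
    simp only [sDeriv_speed, sDeriv_speedS, Pi.mul_apply, Pi.pow_apply, Pi.add_apply,
      Pi.div_apply]
    field_simp
    ring
  rw [← sDeriv_speedS, hX.heat_sDeriv ha hX.smooth_speedS ht, hheat, hX.sDeriv_curv hα ht,
    hX.sDeriv_diffusivity hα ht, sDeriv_speedS, diffusivity]
  field_simp
  ring

end IsAlphaCSF

end Evolution

section Cutoff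

/-- The function `r ^ 2 - |X| ^ 2`, which is positive on the part of the curve inside `B_r`. -/
def cutoff (r : ℝ) (X : ℝ → ℝ → Plane) (t p : ℝ) : ℝ := r ^ 2 - ‖X p t‖ ^ 2

namespace IsAlphaCSF

variable {α : ℝ} {X : ℝ → ℝ → Plane} {t p : ℝ}

theorem smooth_cutoff (hX : IsAlphaCSF α X) (r : ℝ) : SmoothPos (cutoff r X) :=
  contDiffOn_const.sub (ContDiffOn.norm_sq ℝ hX.smooth_position)

theorem sDeriv_cutoff (hX : IsAlphaCSF α X) (r : ℝ) (ht : 0 < t) :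
    sDeriv X (cutoff r X) t p = -2 * inner ℝ (X p t) (tangent X t p) := by
  have hpos := hX.smooth_position.pDifferentiableAt (p := p) ht
  have hderiv : HasDerivAt (fun q => ‖X q t‖ ^ 2) _ p := hpos.hasDerivAt.norm_sq
  refine hX.sDeriv_eq_of_hasDerivAt ht ((hderiv.const_sub (r ^ 2)).congr_deriv ?_)
  rw [show deriv (position X t) p = _ from hX.pDeriv_eq_smul_sDeriv ht (position X),
    real_inner_smul_right]
  change -(2 * (_ * inner ℝ (X p t) (tangent X t p))) = _
  ring

theorem sDeriv_sDeriv_cutoff (hX : IsAlphaCSF α X) (r : ℝ) (ht : 0 < t) :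
    sDeriv X (sDeriv X (cutoff r X)) t p
      = -2 * (1 + curv X t p * inner ℝ (X p t) (normal X t p)) := by
  have hinner : sDeriv X (fun t p => inner ℝ (X p t) (tangent X t p)) t p
      = inner ℝ (X p t) (sDeriv X (tangent X) t p) + inner ℝ (tangent X t p) (tangent X t p) :=
    arcDeriv_inner (hX.smooth_position.pDifferentiableAt ht)
      (hX.smooth_tangent.pDifferentiableAt ht)
  rw [sDeriv_congr (fun _ _ => hX.sDeriv_cutoff r) ht]
  refine hX.sDeriv_eq_of_hasDerivAt ht (((hX.hasDerivAt_slice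
    (hX.smooth_position.inner hX.smooth_tangent) ht).const_mul (-2)).congr_deriv ?_)
  change -2 * (_ * sDeriv X (fun t p => inner ℝ (X p t) (tangent X t p)) t p) = _
  rw [hinner, hX.sDeriv_tangent ht, hX.inner_tangent_self ht, real_inner_smul_right]
  ring

theorem heat_cutoff (hX : IsAlphaCSF α X) (r : ℝ) (hα : 0 < α) (ht : 0 < t) :
    heat X (diffusivity α X) (cutoff r X) t p
      = diffusivity α X t p
        * (2 + 2 * (1 - α⁻¹) * curv X t p * inner ℝ (X p t) (normal X t p)) := by
  have hκ := (hX.curv_pos (p := p) ht).ne'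
  have htime : tDeriv (cutoff r X) t p
      = -2 * speed α X t p * inner ℝ (X p t) (normal X t p) := by
    have hderiv : HasDerivAt (fun τ => ‖X p τ‖ ^ 2) _ t := (hX.flow p t ht).norm_sq
    refine (hderiv.const_sub (r ^ 2)).deriv.trans ?_
    rw [real_inner_smul_right]
    change -(2 * (speed α X t p * inner ℝ (X p t) (normal X t p))) = _
    ring
  rw [heat, htime, hX.sDeriv_sDeriv_cutoff r ht, diffusivity]
  field_simp
  ring

theorem abs_inner_tangent_le (hX : IsAlphaCSF α X) (ht : 0 < t) :
    |inner ℝ (X p t) (tangent X t p)| ≤ ‖X p t‖ := by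
  simpa [hX.norm_tangent ht] using abs_real_inner_le_norm (X p t) (tangent X t p)

theorem abs_inner_normal_le (hX : IsAlphaCSF α X) (ht : 0 < t) :
    |inner ℝ (X p t) (normal X t p)| ≤ ‖X p t‖ := by
  simpa [hX.norm_normal ht] using abs_real_inner_le_norm (X p t) (normal X t p)

end IsAlphaCSF

end Cutoff

section Scaled

/-- The quotient `f / u ^ b` of a function by a power of the speed. -/
def scaled (α b : ℝ) (X : ℝ → ℝ → Plane) (f : ℝ → ℝ → ℝ) : ℝ → ℝ → ℝ :=
  f * fun t p => speed α X t p ^ (-b)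

namespace IsAlphaCSF

variable {α b : ℝ} {X : ℝ → ℝ → Plane} {f : ℝ → ℝ → ℝ} {t p : ℝ}

theorem smooth_speed_rpow (hX : IsAlphaCSF α X) (b : ℝ) :
    SmoothPos fun t p => speed α X t p ^ b :=
  hX.smooth_speed.rpow (fun _ _ ht => (hX.speed_pos ht).ne') b

theorem smooth_scaled (hX : IsAlphaCSF α X) (hf : SmoothPos f) : SmoothPos (scaled α b X f) :=
  hf.mul (hX.smooth_speed_rpow (-b))

theorem scaled_ne_zero (hX : IsAlphaCSF α X) (ht : 0 < t) (hf0 : f t p ≠ 0) :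
    scaled α b X f t p ≠ 0 :=
  mul_ne_zero hf0 (Real.rpow_pos_of_pos (hX.speed_pos ht) _).ne'

theorem logSDeriv_scaled (hX : IsAlphaCSF α X) (hf : SmoothPos f) (hf0 : f t p ≠ 0)
    (ht : 0 < t) :
    logSDeriv X (scaled α b X f) t p
      = logSDeriv X f t p - b * (speedS α X t p / speed α X t p) := by
  have hu := hX.speed_pos (p := p) ht
  rw [scaled, logSDeriv_mul hf (hX.smooth_speed_rpow _) ht hf0 (Real.rpow_pos_of_pos hu _).ne',
    logSDeriv_rpow hX.smooth_speed hu _ ht, logSDeriv, logSDeriv, sDeriv_speed]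
  ring

theorem logHeat_speed (hX : IsAlphaCSF α X) (ht : 0 < t) :
    logHeat X (diffusivity α X) (speed α X) t p
      = diffusivity α X t p * (curv X t p ^ 2 + (speedS α X t p / speed α X t p) ^ 2) := by
  have hu := (hX.speed_pos (p := p) ht).ne'
  rw [logHeat, hX.heat_speed ht, logSDeriv, sDeriv_speed]
  field_simp

theorem logHeat_scaled (hX : IsAlphaCSF α X) (hf : SmoothPos f) (hf0 : f t p ≠ 0) (ht : 0 < t) :
    logHeat X (diffusivity α X) (scaled α b X f) t p
      = logHeat X (diffusivity α X) f t p
        - b * diffusivity α X t p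
          * (curv X t p ^ 2 + (speedS α X t p / speed α X t p) ^ 2) := by
  have hu := hX.speed_pos (p := p) ht
  rw [scaled, hX.logHeat_mul hf (hX.smooth_speed_rpow _) ht hf0 (Real.rpow_pos_of_pos hu _).ne',
    hX.logHeat_rpow hX.smooth_speed (fun _ _ => hX.speed_pos) _ ht, hX.logHeat_speed ht]
  ring

theorem sDeriv_scaled_speedS (hX : IsAlphaCSF α X) (ht : 0 < t) :
    sDeriv X (scaled α b X (speedS α X)) t p
      = (speedSS α X t p - b * speedS α X t p ^ 2 / speed α X t p) * speed α X t p ^ (-b) := by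
  have hu := hX.speed_pos (p := p) ht
  rw [scaled, sDeriv_mul hX.smooth_speedS (hX.smooth_speed_rpow _) ht,
    sDeriv_comp (Real.hasDerivAt_rpow_const (.inl hu.ne')) hX.smooth_speed ht,
    Real.rpow_sub_one hu.ne', sDeriv_speed, sDeriv_speedS]
  ring

theorem heat_scaled_speedS (hX : IsAlphaCSF α X) (hα : 0 < α) (ht : 0 < t) :
    heat X (diffusivity α X) (scaled α b X (speedS α X)) t p
      = diffusivity α X t p * speed α X t p ^ (-b) * (
        (2 + 2 * α⁻¹ - b) * curv X t p ^ 2 * speedS α X t p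
        + (1 - α⁻¹ + 2 * b) * speedS α X t p * speedSS α X t p / speed α X t p
        - b * (b + 1) * speedS α X t p ^ 3 / speed α X t p ^ 2) := by
  have hu := hX.speed_pos (p := p) ht
  have hpow : ∀ b x : ℝ, 0 < x → HasDerivAt (fun y => y ^ b) (b * x ^ (b - 1)) x :=
    fun b x hx => Real.hasDerivAt_rpow_const (.inl hx.ne')
  have hlog := hX.logHeat_rpow hX.smooth_speed (fun _ _ => hX.speed_pos) (-b) ht
    (a := diffusivity α X) (p := p)
  rw [hX.logHeat_speed ht, logHeat, logSDeriv_rpow hX.smooth_speed hu _ ht, logSDeriv,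
    sDeriv_speed, ← eq_sub_iff_add_eq, div_eq_iff (Real.rpow_pos_of_pos hu _).ne'] at hlog
  rw [scaled, hX.heat_mul hX.smooth_speedS (hX.smooth_speed_rpow _) ht, hlog,
    hX.heat_speedS hα ht, sDeriv_comp (hpow (-b) _ hu) hX.smooth_speed ht,
    Real.rpow_sub_one hu.ne', sDeriv_speed, sDeriv_speedS]
  field_simp
  ring

end IsAlphaCSF

end Scaled

section Bernstein

/-- The normalized value of the heat operator at the logarithm of `bernsteinFun` where the first
derivative of that function vanishes, see `IsAlphaCSF.logHeat_bernsteinFun`; here `k = 1 / α`,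
`z = u_s / u ^ β`, and `q`, `p`, `h`, `s`, `c` stem from the powers of the speed, from the first
and second derivatives of the cutoff, from the time weight and from the curvature. -/
def bernsteinForm (k β γ l z q p h s c : ℝ) : ℝ :=
  let r := -p + γ * z * q - l * z * (1 - β * z ^ 2 * q)
  2 * (2 * (1 - k) * z * q * r + (1 - k) * q - k * (1 - k) * z ^ 2 * q ^ 2 + (2 + 3 * k) * c ^ 2
      + (2 + 2 * k) * (1 + k) * c ^ 2 * z ^ 2 * q + r ^ 2)
    + 2 * (h + p ^ 2) + s - 2 * γ * (c ^ 2 + z ^ 2 * q ^ 2)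
    + 2 * l * (z * ((2 + 2 * k - β) * c ^ 2 * z + (1 - k + 2 * β) * z * q
        - β * (β + 1) * z ^ 3 * q ^ 2) - (1 - β * z ^ 2 * q) ^ 2)

theorem exists_pos_forall_neg_of_isCompact {Y E : Type*} [TopologicalSpace Y]
    [SeminormedAddCommGroup E] {S : Set Y} (hS : IsCompact S) {Ψ : Y × E → ℝ} (hΨ : Continuous Ψ)
    (h0 : ∀ z ∈ S, Ψ (z, 0) < 0) : ∃ δ > 0, ∀ z ∈ S, ∀ y : E, ‖y‖ < δ → Ψ (z, y) < 0 := by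
  have hzero : S ×ˢ {0} ⊆ Ψ ⁻¹' Iio 0 := by
    rintro ⟨z, y⟩ ⟨hz, hy⟩
    obtain rfl : y = 0 := hy
    exact h0 z hz
  obtain ⟨U, V, -, hV, hU, hV0, hUV⟩ := generalized_tube_lemma hS isCompact_singleton
    (isOpen_Iio.preimage hΨ) hzero
  obtain ⟨δ, hδ, hball⟩ := Metric.isOpen_iff.1 hV 0 (hV0 rfl)
  exact ⟨δ, hδ, fun z hz y hy => hUV (mk_mem_prod (hU hz) (hball (mem_ball_zero_iff.2 hy)))⟩

theorem exists_bernsteinForm_neg (k β γ : ℝ) {l B : ℝ} (hl : 0 < l) (hB : l * B ^ 2 < 1) :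
    ∃ δ > 0, ∀ z q p h s c : ℝ, |z| ≤ B → |q| < δ → |p| < δ → |h| < δ → |s| < δ → |c| < δ →
      bernsteinForm k β γ l z q p h s c < 0 := by
  have hcont : Continuous fun x : ℝ × (Fin 5 → ℝ) =>
      bernsteinForm k β γ l x.1 (x.2 0) (x.2 1) (x.2 2) (x.2 3) (x.2 4) := by
    unfold bernsteinForm
    fun_prop
  have hneg : ∀ z ∈ Icc (-B) B, bernsteinForm k β γ l z 0 0 0 0 0 < 0 := fun z hz => by
    have hz2 : z ^ 2 ≤ B ^ 2 := sq_le_sq' hz.1 hz.2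
    have hval : bernsteinForm k β γ l z 0 0 0 0 0 = 2 * l * (l * z ^ 2 - 1) := by
      unfold bernsteinForm
      ring
    rw [hval]
    exact mul_neg_of_pos_of_neg (by positivity)
      (sub_neg.2 ((mul_le_mul_of_nonneg_left hz2 hl.le).trans_lt hB))
  obtain ⟨δ, hδ, h⟩ := exists_pos_forall_neg_of_isCompact isCompact_Icc hcont hneg
  refine ⟨δ, hδ, fun z q p h' s c hz hq hp hh hs hc => h z (abs_le.1 hz) ![q, p, h', s, c] ?_⟩
  rw [pi_norm_lt_iff hδ, Fin.forall_fin_succ]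
  simp [Fin.forall_fin_succ, hq, hp, hh, hs, hc]

theorem smooth_time_sub (t₁ : ℝ) : SmoothPos fun t _ => t - t₁ :=
  (contDiff_fst.sub contDiff_const).contDiffOn

theorem logSDeriv_time_sub (X : ℝ → ℝ → Plane) (t₁ t p : ℝ) :
    logSDeriv X (fun t _ => t - t₁) t p = 0 := by
  simp [logSDeriv, sDeriv, arcDeriv]

theorem logHeat_time_sub (X : ℝ → ℝ → Plane) (a : ℝ → ℝ → ℝ) (t₁ t p : ℝ) :
    logHeat X a (fun t _ => t - t₁) t p = 1 / (t - t₁) := by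
  have hs : sDeriv X (fun t _ => t - t₁) = fun _ _ => (0 : ℝ) := by
    funext t p; simp [sDeriv, arcDeriv]
  rw [logHeat, logSDeriv_time_sub, heat, hs]
  simp [tDeriv, sDeriv, arcDeriv]

/-- The function `η² u_ss² u ^ (-2γ) (t - t₁) exp (l u_s² u ^ (-2β))` with `η = r² - |X|²`, to which
the maximum principle is applied. -/
def bernsteinFun (α β γ l r t₁ : ℝ) (X : ℝ → ℝ → Plane) : ℝ → ℝ → ℝ :=
  (cutoff r X * scaled α γ X (speedSS α X)) * (cutoff r X * scaled α γ X (speedSS α X))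
    * (fun t _ => t - t₁) * (fun t p => Real.exp (l * scaled α β X (speedS α X) t p ^ 2))

namespace IsAlphaCSF

variable {α β γ l r t₁ : ℝ} {X : ℝ → ℝ → Plane} {t p : ℝ}

theorem smooth_weight_exponent (hX : IsAlphaCSF α X) (l : ℝ) :
    SmoothPos fun t p => l * scaled α β X (speedS α X) t p ^ 2 :=
  contDiffOn_const.mul (ContDiffOn.pow (hX.smooth_scaled hX.smooth_speedS) 2)

theorem smooth_bernsteinFun (hX : IsAlphaCSF α X) : SmoothPos (bernsteinFun α β γ l r t₁ X) :=
  have hW := (hX.smooth_cutoff r).mul (hX.smooth_scaled (b := γ) hX.smooth_speedSS)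
  ((hW.mul hW).mul (smooth_time_sub t₁)).mul (hX.smooth_weight_exponent l).exp

end IsAlphaCSF

theorem hasDerivAt_const_mul_sq (l x : ℝ) :
    HasDerivAt (fun y : ℝ => l * y ^ 2) (2 * l * x) x :=
  ((hasDerivAt_pow 2 x).const_mul l).congr_deriv (by push_cast; ring)

namespace IsAlphaCSF

variable {α β γ l r t₁ : ℝ} {X : ℝ → ℝ → Plane} {t p : ℝ}

theorem logSDeriv_bernsteinFun (hX : IsAlphaCSF α X) (ht : 0 < t) (htt : t - t₁ ≠ 0)
    (hη : cutoff r X t p ≠ 0) (hw : speedSS α X t p ≠ 0) :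
    logSDeriv X (bernsteinFun α β γ l r t₁ X) t p
      = 2 * (logSDeriv X (cutoff r X) t p + logSDeriv X (speedSS α X) t p
          - γ * (speedS α X t p / speed α X t p))
        + 2 * l * scaled α β X (speedS α X) t p * sDeriv X (scaled α β X (speedS α X)) t p := by
  have hη' := hX.smooth_cutoff r
  have hw' := hX.smooth_scaled (b := γ) hX.smooth_speedSS
  have hw0 := hX.scaled_ne_zero (b := γ) ht hw
  have hz := hX.smooth_scaled (b := β) hX.smooth_speedS
  have hz2 := hX.smooth_weight_exponent (β := β) l
  have hηw := hη'.mul hw'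
  have hηw0 : (cutoff r X * scaled α γ X (speedSS α X)) t p ≠ 0 := mul_ne_zero hη hw0
  rw [bernsteinFun, logSDeriv_mul ((hηw.mul hηw).mul (smooth_time_sub t₁)) hz2.exp ht
      (mul_ne_zero (mul_ne_zero hηw0 hηw0) htt) (Real.exp_ne_zero _),
    logSDeriv_mul (hηw.mul hηw) (smooth_time_sub t₁) ht
      (mul_ne_zero hηw0 hηw0) htt,
    logSDeriv_mul hηw hηw ht hηw0 hηw0,
    logSDeriv_mul hη' hw' ht hη hw0,
    hX.logSDeriv_scaled hX.smooth_speedSS hw ht, logSDeriv_time_sub,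
    logSDeriv_exp hz2 ht,
    sDeriv_comp (hasDerivAt_const_mul_sq l _) hz ht]
  ring

theorem logHeat_bernsteinFun_eq (hX : IsAlphaCSF α X) (ht : 0 < t) (htt : t - t₁ ≠ 0)
    (hη : cutoff r X t p ≠ 0) (hw : speedSS α X t p ≠ 0) :
    logHeat X (diffusivity α X) (bernsteinFun α β γ l r t₁ X) t p
      = 2 * (logHeat X (diffusivity α X) (cutoff r X) t p
          + logHeat X (diffusivity α X) (speedSS α X) t p - γ * diffusivity α X t p
            * (curv X t p ^ 2 + (speedS α X t p / speed α X t p) ^ 2))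
        + 1 / (t - t₁)
        + 2 * l * (scaled α β X (speedS α X) t p
            * heat X (diffusivity α X) (scaled α β X (speedS α X)) t p
          - diffusivity α X t p * sDeriv X (scaled α β X (speedS α X)) t p ^ 2) := by
  have hη' := hX.smooth_cutoff r
  have hw' := hX.smooth_scaled (b := γ) hX.smooth_speedSS
  have hw0 := hX.scaled_ne_zero (b := γ) ht hw
  have hz := hX.smooth_scaled (b := β) hX.smooth_speedS
  have hz2 := hX.smooth_weight_exponent (β := β) l
  have hηw := hη'.mul hw'
  have hηw0 : (cutoff r X * scaled α γ X (speedSS α X)) t p ≠ 0 := mul_ne_zero hη hw0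
  rw [bernsteinFun, hX.logHeat_mul ((hηw.mul hηw).mul (smooth_time_sub t₁)) hz2.exp ht
      (mul_ne_zero (mul_ne_zero hηw0 hηw0) htt) (Real.exp_ne_zero _),
    hX.logHeat_mul (hηw.mul hηw) (smooth_time_sub t₁) ht
      (mul_ne_zero hηw0 hηw0) htt,
    hX.logHeat_mul hηw hηw ht hηw0 hηw0,
    hX.logHeat_mul hη' hw' ht hη hw0,
    hX.logHeat_scaled hX.smooth_speedSS hw ht, logHeat_time_sub,
    hX.logHeat_exp hz2 ht,
    hX.heat_comp (Φ'' := fun _ => 2 * l) hz (fun _ _ _ => hasDerivAt_const_mul_sq l _)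
      (fun _ _ _ => ((hasDerivAt_id _).const_mul (2 * l)).congr_deriv (mul_one _)) ht]
  ring

end IsAlphaCSF

theorem mul_bernsteinForm_eq {k β γ l a u v w w' κ η η' H τ V : ℝ} (ha : a ≠ 0) (hu : u ≠ 0)
    (hw : w ≠ 0) (hη : η ≠ 0) (hτ : τ ≠ 0) (hV : V ≠ 0)
    (hcrit : 2 * (η' / η + w' / w - γ * (v / u))
      + 2 * l * (v * V) * ((w - β * v ^ 2 / u) * V) = 0) :
    2 * (H / η + a * (η' / η) ^ 2
        + (a * (2 * (1 - k) * v * w' / u + (1 - k) * w ^ 2 / u - k * (1 - k) * v ^ 2 * w / u ^ 2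
            + (2 + 3 * k) * κ ^ 2 * w + (2 + 2 * k) * (1 + k) * κ ^ 2 * v ^ 2 / u) / w
          + a * (w' / w) ^ 2)
        - γ * a * (κ ^ 2 + (v / u) ^ 2)) + 1 / τ
      + 2 * l * (v * V * (a * V * ((2 + 2 * k - β) * κ ^ 2 * v + (1 - k + 2 * β) * v * w / u
            - β * (β + 1) * v ^ 3 / u ^ 2)) - a * ((w - β * v ^ 2 / u) * V) ^ 2)
      = a * (w * V) ^ 2 * bernsteinForm k β γ l (v * V) (V⁻¹ / u / (w * V)) (η' / η / (w * V))
        (H / (a * η * (w * V) ^ 2)) (1 / (a * τ * (w * V) ^ 2)) (κ / (w * V)) := by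
  obtain rfl : w' = w * (-(η' / η) + γ * (v / u) - l * (v * V) * ((w - β * v ^ 2 / u) * V)) := by
    rw [mul_comm, ← div_eq_iff hw]
    linarith
  rw [bernsteinForm]
  field_simp
  ring

namespace IsAlphaCSF

variable {α β γ l r t₁ : ℝ} {X : ℝ → ℝ → Plane} {t p : ℝ}

theorem logHeat_bernsteinFun (hX : IsAlphaCSF α X) (hα : 0 < α) (ht : 0 < t)
    (htt : t - t₁ ≠ 0) (hη : cutoff r X t p ≠ 0) (hw : speedSS α X t p ≠ 0)
    (hcrit : sDeriv X (bernsteinFun α β γ l r t₁ X) t p = 0) {a W : ℝ}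
    (ha : diffusivity α X t p = a) (hW : scaled α β X (speedSS α X) t p = W) :
    logHeat X (diffusivity α X) (bernsteinFun α β γ l r t₁ X) t p
      = a * W ^ 2 * bernsteinForm α⁻¹ β γ l (scaled α β X (speedS α X) t p)
        (speed α X t p ^ (β - 1) / W) (sDeriv X (cutoff r X) t p / cutoff r X t p / W)
        (heat X (diffusivity α X) (cutoff r X) t p / (a * cutoff r X t p * W ^ 2))
        (1 / (a * (t - t₁) * W ^ 2)) (curv X t p / W) := by
  have hu := hX.speed_pos (p := p) ht
  have hV : speed α X t p ^ (-β) ≠ 0 := (Real.rpow_pos_of_pos hu _).ne'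
  have hlog := hX.logSDeriv_bernsteinFun (β := β) (γ := γ) (l := l) ht htt hη hw
  rw [logSDeriv, hcrit, zero_div, hX.sDeriv_scaled_speedS ht] at hlog
  have hq : speed α X t p ^ (β - 1) = (speed α X t p ^ (-β))⁻¹ / speed α X t p := by
    rw [Real.rpow_sub_one hu.ne', Real.rpow_neg hu.le, inv_inv]
  rw [hX.logHeat_bernsteinFun_eq ht htt hη hw, hX.heat_scaled_speedS hα ht,
    hX.sDeriv_scaled_speedS ht, logHeat, logHeat, hX.heat_speedSS hα ht, hq, ← ha, ← hW]
  exact mul_bernsteinForm_eq (hX.diffusivity_pos hα ht).ne' hu.ne' hw hη htt hV hlog.symm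

end IsAlphaCSF

end Bernstein

section MaximumPrinciple

theorem deriv_deriv_nonpos_of_isLocalMax {f : ℝ → ℝ} {x : ℝ} (hmax : IsLocalMax f x)
    (hf : ContinuousAt f x) : deriv (deriv f) x ≤ 0 := by
  by_contra! hpos
  have hmin := isLocalMin_of_deriv_deriv_pos hpos hmax.deriv_eq_zero hf
  have hconst : f =ᶠ[𝓝 x] fun _ => f x := by
    filter_upwards [hmin, hmax] with y h₁ h₂ using le_antisymm h₂ h₁
  have hzero : deriv (deriv f) x = 0 := by simp [hconst.deriv.deriv_eq]
  exact hpos.ne' hzero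

theorem deriv_nonneg_of_eventually_le_nhdsLT {f : ℝ → ℝ} {x : ℝ} (hf : DifferentiableAt ℝ f x)
    (h : ∀ᶠ y in 𝓝[<] x, f y ≤ f x) : 0 ≤ deriv f x := by
  have hslope := (hasDerivWithinAt_iff_tendsto_slope' self_notMem_Iio).1
    (hf.hasDerivAt.hasDerivWithinAt (s := Iio x))
  refine ge_of_tendsto hslope ?_
  filter_upwards [h, self_mem_nhdsWithin] with y hy hlt
  rw [slope_def_field]
  exact div_nonneg_of_nonpos (sub_nonpos.2 hy) (sub_nonpos.2 (mem_Iio.1 hlt).le)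

namespace IsAlphaCSF

variable {α : ℝ} {X : ℝ → ℝ → Plane} {f : ℝ → ℝ → ℝ} {L r R t t₀ t₁ p : ℝ}

theorem sDeriv_eq_zero_of_isLocalMax (hmax : IsLocalMax (f t) p) : sDeriv X f t p = 0 := by
  rw [sDeriv, arcDeriv, hmax.deriv_eq_zero, smul_zero]

theorem sDeriv_sDeriv_nonpos_of_isLocalMax (hX : IsAlphaCSF α X) (hf : SmoothPos f)
    (ht : 0 < t) (hmax : IsLocalMax (f t) p) : sDeriv X (sDeriv X f) t p ≤ 0 := by
  have hdd : deriv (deriv (f t)) p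
      = lengthElement X t p * lengthElement X t p * sDeriv X (sDeriv X f) t p := by
    rw [show deriv (f t) = lengthElement X t * sDeriv X f t from
      funext fun q => hX.pDeriv_eq_smul_sDeriv ht f]
    refine (((hX.smooth_lengthElement.pDifferentiableAt ht).hasDerivAt.mul
      (hX.hasDerivAt_slice (hX.smooth_sDeriv hf) ht)).congr_deriv ?_).deriv
    rw [sDeriv_eq_zero_of_isLocalMax hmax]
    ring
  have hle := deriv_deriv_nonpos_of_isLocalMax hmax (hf.pDifferentiableAt ht).continuousAt
  rw [hdd] at hle
  exact nonpos_of_mul_nonpos_right hle (mul_self_pos.2 (hX.lengthElement_ne_zero ht))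

theorem norm_tDeriv_position (hX : IsAlphaCSF α X) (ht : 0 < t) :
    ‖tDeriv (position X) t p‖ = speed α X t p := by
  rw [hX.tDeriv_position ht, norm_smul, hX.norm_normal ht, mul_one,
    Real.norm_of_nonneg (hX.speed_pos ht).le]

theorem norm_le_of_norm_le_later (hX : IsAlphaCSF α X)
    (hL : ∀ t p, 0 < t → ‖X p t‖ < R → speed α X t p ≤ L) {b : ℝ} (hb : 0 < b) (hbt : b ≤ t)
    (hp : ‖X p t‖ ≤ r) (hR : r + (|L| + 1) * (t - b) < R) :
    ‖X p b‖ ≤ r + (|L| + 1) * (t - b) := by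
  have hback : ∀ s < t,
      HasDerivAt (fun s => X p (t - s)) (-tDeriv (position X) (t - s) p) s := fun s hs =>
    (hX.smooth_position.tDifferentiableAt (sub_pos.2 hs)).hasDerivAt.comp_const_sub t s
  have hbound := image_norm_le_of_norm_deriv_right_lt_deriv_boundary
    (f := fun s => X p (t - s)) (f' := fun s => -tDeriv (position X) (t - s) p)
    (a := 0) (b := t - b) (B := fun s => r + (|L| + 1) * s) (B' := fun _ => |L| + 1)
    (fun s hs => (hback s (by linarith [hs.2])).continuousAt.continuousWithinAt)
    (fun s hs => (hback s (by linarith [hs.2])).hasDerivWithinAt)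
    (by simpa using hp)
    (fun s => by simpa using ((hasDerivAt_id s).const_mul (|L| + 1)).const_add r)
    (fun s hs hs' => by
      have hpos : 0 < t - s := by linarith [hs.2]
      have hmono : (|L| + 1) * s ≤ (|L| + 1) * (t - b) := by gcongr; exact hs.2.le
      have hspeed := hL (t - s) p hpos (by linarith)
      rw [norm_neg, hX.norm_tDeriv_position hpos]
      linarith [le_abs_self L])
    (right_mem_Icc.2 (sub_nonneg.2 hbt))
  simpa using hbound

theorem exists_mem_nhds_abs_le (hX : IsAlphaCSF α X)
    (hL : ∀ t p, 0 < t → ‖X p t‖ < R → speed α X t p ≤ L) (hrR : r < R) (ht : 0 < t) :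
    ∃ N ∈ 𝓝 t, ∃ P, ∀ s ∈ N, ∀ p, ‖X p s‖ ≤ r → |p| ≤ P := by
  obtain ⟨d, ⟨hd0, hdt⟩, hd⟩ : ∃ d ∈ Ioo 0 t, r + (|L| + 1) * (2 * d) < R := by
    have hcont : Tendsto (fun d => r + (|L| + 1) * (2 * d)) (𝓝[>] 0) (𝓝 r) :=
      tendsto_nhdsWithin_of_tendsto_nhds <| by
        simpa using (by fun_prop : Continuous fun d => r + (|L| + 1) * (2 * d)).tendsto 0
    have hsmall : ∀ᶠ d in 𝓝[>] (0 : ℝ), d ∈ Ioo 0 t := Ioo_mem_nhdsGT ht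
    exact (hsmall.and (hcont.eventually_lt_const hrR)).exists
  have hslice := (hX.slice (t - d) (sub_pos.2 hdt).le).isClosedEmbedding
  obtain ⟨P, hP⟩ := (hslice.isCompact_preimage
    (isCompact_closedBall (0 : Plane) R)).isBounded.exists_norm_le
  refine ⟨Ioo (t - d) (t + d), Ioo_mem_nhds (sub_lt_self t hd0) (lt_add_of_pos_right t hd0), P,
    fun s hs p hp => hP p (mem_closedBall_zero_iff.2 ?_)⟩
  have hstep : r + (|L| + 1) * (s - (t - d)) < R :=
    lt_of_le_of_lt (by gcongr; linarith [hs.2]) hd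
  exact (hX.norm_le_of_norm_le_later hL (sub_pos.2 hdt) hs.1.le hp hstep).trans hstep.le

theorem isCompact_setOf_norm_le (hX : IsAlphaCSF α X)
    (hL : ∀ t p, 0 < t → ‖X p t‖ < R → speed α X t p ≤ L) (hrR : r < R) (ht₁ : 0 < t₁) :
    IsCompact {z : ℝ × ℝ | z.1 ∈ Icc t₁ t₀ ∧ ‖X z.2 z.1‖ ≤ r} := by
  obtain ⟨P, hP⟩ : ∃ P, ∀ t ∈ Icc t₁ t₀, ∀ p, ‖X p t‖ ≤ r → |p| ≤ P := by
    refine isCompact_Icc.induction_on (p := fun S => ∃ P, ∀ t ∈ S, ∀ p, ‖X p t‖ ≤ r → |p| ≤ P)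
      ⟨0, fun t ht => ht.elim⟩ (fun S S' hS ⟨P, hP⟩ => ⟨P, fun t ht => hP t (hS ht)⟩) ?_ ?_
    · rintro S S' ⟨P, hP⟩ ⟨P', hP'⟩
      exact ⟨max P P', fun t ht p hp => ht.elim (fun ht => (hP t ht p hp).trans (le_max_left ..))
        fun ht => (hP' t ht p hp).trans (le_max_right ..)⟩
    · intro t ht
      obtain ⟨N, hN, hP⟩ := hX.exists_mem_nhds_abs_le hL hrR (ht₁.trans_le ht.1)
      exact ⟨N, mem_nhdsWithin_of_mem_nhds hN, hP⟩
  have hK : IsCompact (Icc t₁ t₀ ×ˢ Icc (-P) P) := isCompact_Icc.prod isCompact_Icc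
  have hcont : ContinuousOn (fun z : ℝ × ℝ => ‖X z.2 z.1‖) (Icc t₁ t₀ ×ˢ Icc (-P) P) :=
    (hX.smooth_position.continuousOn.mono fun _ hz => ⟨ht₁.trans_le hz.1.1, trivial⟩).norm
  have hclosed := hcont.preimage_isClosed_of_isClosed hK.isClosed (isClosed_Iic (a := r))
  convert hK.of_isClosed_subset hclosed inter_subset_left using 1
  ext z
  exact ⟨fun hz => ⟨⟨hz.1, abs_le.1 (hP _ hz.1 _ hz.2)⟩, hz.2⟩, fun hz => ⟨hz.1.1, hz.2⟩⟩

theorem exists_interior_max (hX : IsAlphaCSF α X)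
    (hL : ∀ t p, 0 < t → ‖X p t‖ < R → speed α X t p ≤ L) (hrR : r < R) (ht₁ : 0 < t₁)
    (ht : t₁ ≤ t₀) (hf : SmoothPos f) (hinit : ∀ p, f t₁ p ≤ 0)
    (hbdry : ∀ t p, ‖X p t‖ = r → f t p ≤ 0) {p₀ : ℝ} (hp₀ : ‖X p₀ t₀‖ ≤ r)
    (hpos : 0 < f t₀ p₀) :
    ∃ t ∈ Ioc t₁ t₀, ∃ p, ‖X p t‖ < r ∧ f t₀ p₀ ≤ f t p ∧ sDeriv X f t p = 0 ∧
      ∀ a : ℝ → ℝ → ℝ, 0 ≤ a t p → 0 ≤ heat X a f t p := by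
  set S : Set (ℝ × ℝ) := {z | z.1 ∈ Icc t₁ t₀ ∧ ‖X z.2 z.1‖ ≤ r}
  have hcont : ContinuousOn (Function.uncurry f) S :=
    hf.continuousOn.mono fun z hz => ⟨ht₁.trans_le hz.1.1, trivial⟩
  obtain ⟨⟨t, p⟩, ⟨⟨ht₁t, htt₀⟩, hpr⟩, hmax⟩ :=
    (hX.isCompact_setOf_norm_le hL hrR ht₁).exists_isMaxOn
      (⟨(t₀, p₀), ⟨ht, le_rfl⟩, hp₀⟩ : S.Nonempty) hcont
  have hmax : ∀ t' p', t' ∈ Icc t₁ t₀ → ‖X p' t'‖ ≤ r → f t' p' ≤ f t p := fun t' p' h h' =>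
    hmax (show (t', p') ∈ S from ⟨h, h'⟩)
  have hge := hmax t₀ p₀ ⟨ht, le_rfl⟩ hp₀
  have htp : 0 < f t p := hpos.trans_le hge
  have ht₁t' : t₁ < t := ht₁t.lt_of_ne fun h => (hinit p).not_gt (h ▸ htp)
  have hpr' : ‖X p t‖ < r := hpr.lt_of_ne fun h => (hbdry t p h).not_gt htp
  have ht0 : 0 < t := ht₁.trans ht₁t'
  have hspace : IsLocalMax (f t) p := by
    filter_upwards [(hX.smooth_position.pDifferentiableAt ht0).continuousAt.norm.eventually_lt_const
      hpr'] with q hq using hmax t q ⟨ht₁t, htt₀⟩ hq.le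
  have htime : ∀ᶠ τ in 𝓝[<] t, f τ p ≤ f t p := by
    filter_upwards [Ioo_mem_nhdsLT ht₁t', mem_nhdsWithin_of_mem_nhds <|
      (hX.smooth_position.tDifferentiableAt ht0).continuousAt.norm.eventually_lt_const hpr']
      with τ hτ hq using hmax τ p ⟨hτ.1.le, hτ.2.le.trans htt₀⟩ (le_of_lt hq)
  refine ⟨t, ⟨ht₁t', htt₀⟩, p, hpr', hge, sDeriv_eq_zero_of_isLocalMax hspace, fun a ha => ?_⟩
  have hss := hX.sDeriv_sDeriv_nonpos_of_isLocalMax hf ht0 hspace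
  exact sub_nonneg.2 <| (mul_nonpos_of_nonneg_of_nonpos ha hss).trans
    (deriv_nonneg_of_eventually_le_nhdsLT (hf.tDifferentiableAt ht0) htime)

end IsAlphaCSF

end MaximumPrinciple

section Estimate

namespace IsAlphaCSF

variable {α β γ l r t₁ B δ : ℝ} {X : ℝ → ℝ → Plane} {t p : ℝ}

theorem curv_eq_rpow (hX : IsAlphaCSF α X) (hα : α ≠ 0) (ht : 0 < t) :
    curv X t p = speed α X t p ^ α⁻¹ :=
  (Real.rpow_rpow_inv (hX.curv_pos ht).le hα).symm

theorem inv_diffusivity (hX : IsAlphaCSF α X) (hα : α ≠ 0) (ht : 0 < t) :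
    (diffusivity α X t p)⁻¹ = speed α X t p ^ (α⁻¹ - 1) / α := by
  rw [Real.rpow_sub_one (hX.speed_pos ht).ne', ← hX.curv_eq_rpow hα ht, diffusivity, inv_div,
    div_div, mul_comm]

theorem abs_sDeriv_cutoff_le (hX : IsAlphaCSF α X) (ht : 0 < t) (hp : ‖X p t‖ ≤ 1) :
    |sDeriv X (cutoff r X) t p| ≤ 2 := by
  have hinner := (hX.abs_inner_tangent_le (p := p) ht).trans hp
  rw [hX.sDeriv_cutoff r ht, abs_mul, abs_neg, abs_two]
  linarith

theorem abs_heat_cutoff_le (hX : IsAlphaCSF α X) (hα : 0 < α) (ht : 0 < t) (hp : ‖X p t‖ ≤ 1) :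
    |heat X (diffusivity α X) (cutoff r X) t p|
      ≤ diffusivity α X t p * (2 + 2 * |1 - α⁻¹| * curv X t p) := by
  have ha := hX.diffusivity_pos (p := p) hα ht
  have hκ := hX.curv_pos (p := p) ht
  have hinner := (hX.abs_inner_normal_le (p := p) ht).trans hp
  rw [hX.heat_cutoff r hα ht, abs_mul, abs_of_pos ha]
  refine mul_le_mul_of_nonneg_left ((abs_add_le _ _).trans ?_) ha.le
  rw [abs_two, abs_mul, abs_mul, abs_mul, abs_two, abs_of_pos hκ]
  exact add_le_add_right (mul_le_of_le_one_right (by positivity) hinner) 2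

theorem bernstein_alternative (hX : IsAlphaCSF α X) (hα : 0 < α)
    (hform : ∀ z q p h s c : ℝ, |z| ≤ B → |q| < δ → |p| < δ → |h| < δ → |s| < δ → |c| < δ →
      bernsteinForm α⁻¹ β γ l z q p h s c < 0)
    (ht : 0 < t) (htt : t₁ < t) (hp : ‖X p t‖ ≤ 1) (hη : 0 < cutoff r X t p)
    (hw : speedSS α X t p ≠ 0) (hz : |scaled α β X (speedS α X) t p| ≤ B)
    (hcrit : sDeriv X (bernsteinFun α β γ l r t₁ X) t p = 0)
    (hheat : 0 ≤ logHeat X (diffusivity α X) (bernsteinFun α β γ l r t₁ X) t p) {W : ℝ}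
    (hW : scaled α β X (speedSS α X) t p = W) :
    δ * |W| ≤ speed α X t p ^ (β - 1) ∨ δ * (cutoff r X t p * |W|) ≤ 2 ∨
      δ * (cutoff r X t p * W ^ 2) ≤ 2 + 2 * |1 - α⁻¹| * curv X t p ∨
      δ * ((t - t₁) * W ^ 2) ≤ (diffusivity α X t p)⁻¹ ∨ δ * |W| ≤ curv X t p := by
  have ha := hX.diffusivity_pos (p := p) hα ht
  have hτ : 0 < t - t₁ := sub_pos.2 htt
  have hW0 : W ≠ 0 := hW ▸ hX.scaled_ne_zero ht hw
  have hWpos : 0 < |W| := abs_pos.2 hW0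
  have hW2 : 0 < W ^ 2 := by positivity
  by_contra! hlarge
  obtain ⟨hq, hs, hh, hτW, hκW⟩ := hlarge
  refine hheat.not_gt ?_
  rw [hX.logHeat_bernsteinFun hα ht hτ.ne' hη.ne' hw hcrit rfl hW]
  refine mul_neg_of_pos_of_neg (mul_pos ha hW2) (hform _ _ _ _ _ _ hz ?_ ?_ ?_ ?_ ?_)
  · rwa [abs_div, abs_of_pos (Real.rpow_pos_of_pos (hX.speed_pos ht) _), div_lt_iff₀ hWpos]
  · rw [div_div, abs_div, abs_mul, abs_of_pos hη, div_lt_iff₀ (mul_pos hη hWpos)]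
    exact (hX.abs_sDeriv_cutoff_le ht hp).trans_lt hs
  · rw [abs_div, mul_assoc, abs_of_pos (mul_pos ha (mul_pos hη hW2)),
      div_lt_iff₀ (mul_pos ha (mul_pos hη hW2))]
    refine (hX.abs_heat_cutoff_le hα ht hp).trans_lt ?_
    rw [mul_left_comm]
    exact mul_lt_mul_of_pos_left hh ha
  · rw [mul_assoc, ← div_div, one_div, abs_of_pos (by positivity),
      div_lt_iff₀ (mul_pos hτ hW2)]
    exact hτW
  · rwa [abs_div, abs_of_pos (hX.curv_pos ht), div_lt_iff₀ hWpos]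

end IsAlphaCSF

theorem sq_mul_sq_mul_le_of_alternative {b c δ m q d κ η τ W : ℝ} (hδ : 0 < δ) (hb : 0 ≤ b)
    (hc : 0 ≤ c) (hη0 : 0 ≤ η) (hη1 : η ≤ 1) (hτ0 : 0 ≤ τ) (hτ1 : τ ≤ 1)
    (hm : 1 ≤ m) (hqm : q ^ 2 ≤ m) (hκm : κ ≤ m) (hκm' : κ ^ 2 ≤ m) (hdm : d ≤ b * m)
    (halt : δ * |W| ≤ q ∨ δ * (η * |W|) ≤ 2 ∨ δ * (η * W ^ 2) ≤ 2 + c * κ ∨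
      δ * (τ * W ^ 2) ≤ d ∨ δ * |W| ≤ κ) :
    η ^ 2 * W ^ 2 * τ ≤ (4 / δ ^ 2 + (2 + c + b) / δ) * m := by
  have hquad : ∀ y x, 0 ≤ y → δ * y ≤ x → x ^ 2 ≤ 4 * m → y ^ 2 ≤ 4 / δ ^ 2 * m :=
    fun y x hy hyx hx => by
      rw [div_mul_eq_mul_div, le_div_iff₀' (by positivity), ← mul_pow]
      exact (pow_le_pow_left₀ (by positivity) hyx 2).trans hx
  have hlin : ∀ y, δ * y ≤ (2 + c + b) * m → y ≤ (2 + c + b) / δ * m := fun y hy => by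
    rwa [div_mul_eq_mul_div, le_div_iff₀' hδ]
  have hη2 : η ^ 2 ≤ η := pow_le_of_le_one hη0 hη1 two_ne_zero
  have hητ : η ^ 2 * τ ≤ 1 := mul_le_one₀ (hη2.trans hη1) hτ0 hτ1
  have hsmall : ∀ x, δ * |W| ≤ x → x ^ 2 ≤ m → η ^ 2 * W ^ 2 * τ ≤ 4 / δ ^ 2 * m := fun x h hx =>
    calc η ^ 2 * W ^ 2 * τ = η ^ 2 * τ * |W| ^ 2 := by rw [sq_abs]; ring
      _ ≤ |W| ^ 2 := mul_le_of_le_one_left (by positivity) hητ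
      _ ≤ _ := hquad _ _ (abs_nonneg W) h (by linarith)
  rw [add_mul]
  rcases halt with h | h | h | h | h
  · exact le_add_of_le_of_nonneg (hsmall _ h hqm) (by positivity)
  · refine le_add_of_le_of_nonneg ?_ (by positivity)
    calc η ^ 2 * W ^ 2 * τ ≤ η ^ 2 * W ^ 2 := mul_le_of_le_one_right (by positivity) hτ1
      _ = (η * |W|) ^ 2 := by rw [mul_pow, sq_abs]
      _ ≤ _ := hquad _ _ (by positivity) h (by linarith)
  · refine le_add_of_nonneg_of_le (by positivity) ?_
    calc η ^ 2 * W ^ 2 * τ ≤ η * W ^ 2 * 1 := by gcongr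
      _ ≤ _ := hlin _ (by rw [mul_one]; nlinarith)
  · refine le_add_of_nonneg_of_le (by positivity) ?_
    calc η ^ 2 * W ^ 2 * τ ≤ 1 * W ^ 2 * τ := by gcongr; exact hη2.trans hη1
      _ = τ * W ^ 2 := by ring
      _ ≤ _ := hlin _ (by nlinarith)
  · exact le_add_of_le_of_nonneg (hsmall _ h hκm') (by positivity)

theorem rpow_le_rpow_div_rpow {u L d e E : ℝ} (hu : 0 < u) (huL : u ≤ L) (hL : 1 ≤ L)
    (h0 : 0 ≤ e + d) (hE : e + d ≤ E) : u ^ e ≤ L ^ E / u ^ d := by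
  rw [le_div_iff₀ (Real.rpow_pos_of_pos hu _), ← Real.rpow_add hu]
  exact (Real.rpow_le_rpow hu.le huL h0).trans (Real.rpow_le_rpow_of_exponent_le hL hE)

theorem bernsteinFun_apply (α β γ l r t₁ : ℝ) (X : ℝ → ℝ → Plane) (t p : ℝ) :
    bernsteinFun α β γ l r t₁ X t p = (cutoff r X t p * scaled α γ X (speedSS α X) t p) ^ 2
      * (t - t₁) * Real.exp (l * scaled α β X (speedS α X) t p ^ 2) := by
  simp only [bernsteinFun, Pi.mul_apply, sq]

namespace IsAlphaCSF

variable {α β γ l r t₁ B L δ : ℝ} {X : ℝ → ℝ → Plane} {t p : ℝ}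

theorem scaled_eq_scaled_mul_rpow (hX : IsAlphaCSF α X) (β : ℝ) {f : ℝ → ℝ → ℝ} (ht : 0 < t) :
    scaled α γ X f t p = scaled α β X f t p * speed α X t p ^ (β - γ) := by
  rw [scaled, scaled, Pi.mul_apply, Pi.mul_apply, Pi.mul_apply, Pi.mul_apply, mul_assoc,
    ← Real.rpow_add (hX.speed_pos ht), neg_add_eq_sub, sub_sub_cancel_left]

theorem sq_mul_scaled_le_of_alternative (hX : IsAlphaCSF α X) (hα : 0 < α) (hβ : β ≤ α⁻¹)
    (hγ : γ ≤ 2 * β - 1) (hγβ : γ ≤ β) (hδ : 0 < δ) (hL : 1 ≤ L) (ht : 0 < t)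
    (huL : speed α X t p ≤ L) {η τ W : ℝ} (hη0 : 0 ≤ η) (hη1 : η ≤ 1) (hτ0 : 0 ≤ τ) (hτ1 : τ ≤ 1)
    (hW : scaled α β X (speedSS α X) t p = W)
    (halt : δ * |W| ≤ speed α X t p ^ (β - 1) ∨ δ * (η * |W|) ≤ 2 ∨
      δ * (η * W ^ 2) ≤ 2 + 2 * |1 - α⁻¹| * curv X t p ∨
      δ * (τ * W ^ 2) ≤ (diffusivity α X t p)⁻¹ ∨ δ * |W| ≤ curv X t p) :
    (η * scaled α γ X (speedSS α X) t p) ^ 2 * τ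
      ≤ (4 / δ ^ 2 + (2 + 2 * |1 - α⁻¹| + α⁻¹) / δ) * L ^ (2 * (β - γ) + 2 * α⁻¹) := by
  have hk : 0 < α⁻¹ := inv_pos.2 hα
  have hu := hX.speed_pos (p := p) ht
  rw [hX.inv_diffusivity hα.ne' ht, hX.curv_eq_rpow hα.ne' ht, div_eq_inv_mul] at halt
  rw [hX.scaled_eq_scaled_mul_rpow β ht, hW]
  generalize speed α X t p = u at *
  have hsq : ∀ x : ℝ, (u ^ x) ^ 2 = u ^ (2 * x) := fun x => by
    rw [mul_comm, Real.rpow_mul hu.le, Real.rpow_two]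
  have hpow : ∀ e, 0 ≤ e + 2 * (β - γ) → e ≤ 2 * α⁻¹ →
      u ^ e ≤ L ^ (2 * (β - γ) + 2 * α⁻¹) / u ^ (2 * (β - γ)) := fun e h0 h1 =>
    rpow_le_rpow_div_rpow hu huL hL h0 (by linarith)
  have hone := hpow 0 (by linarith) (by linarith)
  have hgrad := hpow (2 * (β - 1)) (by linarith) (by linarith)
  have hcurv := hpow α⁻¹ (by linarith) (by linarith)
  have hcurv_sq := hpow (2 * α⁻¹) (by linarith) le_rfl
  have hdiff := hpow (α⁻¹ - 1) (by linarith) (by linarith)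
  rw [Real.rpow_zero] at hone
  rw [← hsq] at hgrad hcurv_sq
  have hle := sq_mul_sq_mul_le_of_alternative hδ hk.le (by positivity) hη0 hη1 hτ0 hτ1
    hone hgrad hcurv hcurv_sq (mul_le_mul_of_nonneg_left hdiff hk.le) halt
  rw [← mul_div_assoc, le_div_iff₀ (Real.rpow_pos_of_pos hu _), ← hsq] at hle
  linear_combination hle

theorem bernsteinFun_le_of_heat_nonneg (hX : IsAlphaCSF α X) (hα : 0 < α) (hβ : β ≤ α⁻¹)
    (hγ : γ ≤ 2 * β - 1) (hγβ : γ ≤ β) (hδ : 0 < δ) (hl : 0 ≤ l) (hlB : l * B ^ 2 ≤ 1)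
    (hform : ∀ z q p h s c : ℝ, |z| ≤ B → |q| < δ → |p| < δ → |h| < δ → |s| < δ → |c| < δ →
      bernsteinForm α⁻¹ β γ l z q p h s c < 0)
    (hr : r ∈ Ioc 0 1) (hL : 1 ≤ L) (ht : 0 < t) (htt : t ∈ Ioc t₁ (t₁ + 1)) (hp : ‖X p t‖ < r)
    (huL : speed α X t p ≤ L) (hz : |scaled α β X (speedS α X) t p| ≤ B)
    (hpos : 0 < bernsteinFun α β γ l r t₁ X t p)
    (hcrit : sDeriv X (bernsteinFun α β γ l r t₁ X) t p = 0)
    (hheat : 0 ≤ heat X (diffusivity α X) (bernsteinFun α β γ l r t₁ X) t p) :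
    bernsteinFun α β γ l r t₁ X t p
      ≤ (4 / δ ^ 2 + (2 + 2 * |1 - α⁻¹| + α⁻¹) / δ) * L ^ (2 * (β - γ) + 2 * α⁻¹)
        * Real.exp 1 := by
  have hη : 0 < cutoff r X t p := sub_pos.2 (pow_lt_pow_left₀ hp (norm_nonneg _) two_ne_zero)
  have hη1 : cutoff r X t p ≤ 1 :=
    (sub_le_self _ (sq_nonneg _)).trans (pow_le_one₀ hr.1.le hr.2)
  have hw : speedSS α X t p ≠ 0 := fun hw => by
    simp [bernsteinFun_apply, scaled, hw] at hpos
  have hlogHeat : 0 ≤ logHeat X (diffusivity α X) (bernsteinFun α β γ l r t₁ X) t p := by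
    rw [logHeat, logSDeriv, hcrit, zero_div, zero_pow two_ne_zero, mul_zero, add_zero]
    exact div_nonneg hheat hpos.le
  have halt := hX.bernstein_alternative hα hform ht htt.1 (hp.le.trans hr.2) hη hw hz hcrit
    hlogHeat rfl
  have hz2 : scaled α β X (speedS α X) t p ^ 2 ≤ B ^ 2 := sq_le_sq' (abs_le.1 hz).1 (abs_le.1 hz).2
  rw [bernsteinFun_apply]
  refine mul_le_mul ?_ (Real.exp_le_exp.2 ?_) (Real.exp_pos _).le (by positivity)
  · exact hX.sq_mul_scaled_le_of_alternative hα hβ hγ hγβ hδ hL ht huL hη.le hη1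
      (sub_pos.2 htt.1).le (sub_le_iff_le_add'.2 htt.2) rfl halt
  · exact (mul_le_mul_of_nonneg_left hz2 hl).trans hlB

end IsAlphaCSF

theorem IsAlphaCSF.abs_scaled_le_iff {α b M : ℝ} {X : ℝ → ℝ → Plane} {f : ℝ → ℝ → ℝ} {t p : ℝ}
    (hX : IsAlphaCSF α X) (ht : 0 < t) :
    |scaled α b X f t p| ≤ M ↔ |f t p| ≤ M * speed α X t p ^ b := by
  have hu := hX.speed_pos (p := p) ht
  have hub := Real.rpow_pos_of_pos hu b
  rw [scaled, Pi.mul_apply, Pi.mul_apply, Real.rpow_neg hu.le, ← div_eq_mul_inv, abs_div,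
    abs_of_pos hub, div_le_iff₀ hub]

theorem exists_interior_estimate {α β γ : ℝ} (hα : 0 < α) (hβ : β ≤ α⁻¹) (hγ : γ ≤ 2 * β - 1)
    (hγβ : γ ≤ β) (K : ℝ) {L r : ℝ} (hL : 1 ≤ L) (hr : 0 < r) (hr1 : r < 1) :
    ∃ C > 0, ∀ X, IsAlphaCSF α X →
      (∀ t p, 0 < t → ‖X p t‖ < 1 → |speedS α X t p| ≤ K * speed α X t p ^ β) →
      (∀ t p, 0 < t → ‖X p t‖ < 1 → speed α X t p ≤ L) →
      ∀ t₁ t p, 0 < t₁ → t ∈ Icc t₁ (t₁ + 1) → ‖X p t‖ ≤ r →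
        (cutoff r X t p * scaled α γ X (speedSS α X) t p) ^ 2 * (t - t₁) ≤ C := by
  set l := (1 + K ^ 2)⁻¹
  have hl : 0 < l := by positivity
  have hlK : l * K ^ 2 < 1 := by
    rw [inv_mul_lt_one₀ (by positivity)]
    exact lt_one_add _
  obtain ⟨δ, hδ, hform⟩ := exists_bernsteinForm_neg α⁻¹ β γ hl hlK
  refine ⟨(4 / δ ^ 2 + (2 + 2 * |1 - α⁻¹| + α⁻¹) / δ) * L ^ (2 * (β - γ) + 2 * α⁻¹) * Real.exp 1,
    by positivity, fun X hX hK hL' t₁ t₀ p₀ ht₁ ht₀ hp₀ => ?_⟩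
  set F := bernsteinFun α β γ l r t₁ X with hF
  have hle : (cutoff r X t₀ p₀ * scaled α γ X (speedSS α X) t₀ p₀) ^ 2 * (t₀ - t₁) ≤ F t₀ p₀ := by
    rw [hF, bernsteinFun_apply]
    exact le_mul_of_one_le_right (mul_nonneg (sq_nonneg _) (sub_nonneg.2 ht₀.1))
      (Real.one_le_exp (by positivity))
  refine hle.trans ?_
  rcases le_or_gt (F t₀ p₀) 0 with hneg | hpos
  · exact hneg.trans (by positivity)
  have hinit : ∀ p, F t₁ p ≤ 0 := fun p => by simp [hF, bernsteinFun_apply]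
  have hbdry : ∀ t p, ‖X p t‖ = r → F t p ≤ 0 := fun t p hp => by
    simp [hF, bernsteinFun_apply, cutoff, hp]
  obtain ⟨t, ht, p, hp, hmax, hcrit, hheat⟩ :=
    hX.exists_interior_max hL' hr1 ht₁ ht₀.1 hX.smooth_bernsteinFun hinit hbdry hp₀ hpos
  have ht0 : 0 < t := ht₁.trans ht.1
  exact hmax.trans (hX.bernsteinFun_le_of_heat_nonneg hα hβ hγ hγβ hδ hl.le hlK.le hform
    ⟨hr, hr1.le⟩ hL ht0 ⟨ht.1, ht.2.trans ht₀.2⟩ hp (hL' t p ht0 (hp.trans hr1))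
    ((hX.abs_scaled_le_iff ht0).2 (hK t p ht0 (hp.trans hr1))) (hpos.trans_le hmax) hcrit
    (hheat _ (hX.diffusivity_pos hα ht0).le))

theorem one_le_min_mul_sq {t : ℝ} (ht : 0 < t) :
    1 ≤ min 1 (t / 2) * (2 * (1 + t ^ (-(1 / 2) : ℝ))) ^ 2 := by
  have hpow : 0 < t ^ (-(1 / 2) : ℝ) := Real.rpow_pos_of_pos ht _
  have hsq : (t ^ (-(1 / 2) : ℝ)) ^ 2 = t⁻¹ := by
    rw [← Real.rpow_mul_natCast ht.le, ← Real.rpow_neg_one]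
    norm_num
  have hle : 4 * (1 + t⁻¹) ≤ (2 * (1 + t ^ (-(1 / 2) : ℝ))) ^ 2 := by rw [← hsq]; nlinarith
  have hinv : 0 < t⁻¹ := inv_pos.2 ht
  have hcancel : t * t⁻¹ = 1 := mul_inv_cancel₀ ht.ne'
  refine le_trans ?_ (mul_le_mul_of_nonneg_left hle (by positivity))
  rcases min_choice 1 (t / 2) with h | h <;> rw [h] <;> linarith

theorem abs_le_of_mul_sq_mul_le {c C η s τ w : ℝ} (hc : 0 < c) (hη : c ≤ η) (hC : 0 ≤ C)
    (hs : 0 ≤ s) (hτ : 1 ≤ τ * s ^ 2) (hle : (η * w) ^ 2 * τ ≤ C) : |w| ≤ √C / c * s := by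
  have hroot : |η * w| ≤ √C * s := by
    refine abs_le_of_sq_le_sq ?_ (by positivity)
    calc (η * w) ^ 2 ≤ (η * w) ^ 2 * (τ * s ^ 2) := le_mul_of_one_le_right (sq_nonneg _) hτ
      _ = (η * w) ^ 2 * τ * s ^ 2 := by ring
      _ ≤ C * s ^ 2 := by gcongr
      _ = (√C * s) ^ 2 := by rw [mul_pow, Real.sq_sqrt hC]
  rw [abs_mul, abs_of_pos (hc.trans_le hη)] at hroot
  rw [div_mul_eq_mul_div, le_div_iff₀' hc]
  exact (mul_le_mul_of_nonneg_right hη (abs_nonneg w)).trans hroot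

theorem proposition3p4_general {α β ε : ℝ} (hα : 0 < α) (hβ : β ≤ 1 / α) (hε : 0 ≤ ε) (K L : ℝ) :
    ∃ C : ℝ, 0 < C ∧ ∀ X : ℝ → ℝ → Plane, IsAlphaCSF α X →
      (∀ p t, 0 < t → X p t ∈ Metric.ball (0 : Plane) 1 →
        |speedS α X t p| ≤ K * speed α X t p ^ β) →
      (∀ p t, 0 < t → X p t ∈ Metric.ball (0 : Plane) 1 → speed α X t p ≤ L) →
      ∀ p t, 0 < t → X p t ∈ Metric.ball (0 : Plane) (1 / 2) →
        |speedSS α X t p| ≤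
          C * (1 + t ^ (-(1 / 2) : ℝ)) * speed α X t p ^ (min β (2 * β - 1) - ε) := by
  simp only [mem_ball_zero_iff]
  obtain ⟨C, hC, h⟩ := exists_interior_estimate (r := 3 / 4) hα (hβ.trans_eq (one_div α))
    ((sub_le_self _ hε).trans (min_le_right _ _)) ((sub_le_self _ hε).trans (min_le_left _ _)) K
    (le_max_right L 1) (by norm_num) (by norm_num)
  refine ⟨√C / (5 / 16) * 2, by positivity, fun X hX hK hL p t ht hp => ?_⟩
  have hτ : 0 < min 1 (t / 2) := lt_min one_pos (half_pos ht)
  have hτt : min 1 (t / 2) < t := (min_le_right _ _).trans_lt (half_lt_self ht)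
  have hτ1 : min 1 (t / 2) ≤ 1 := min_le_left _ _
  have hle := h X hX (fun t p ht hp => hK p t ht hp)
    (fun t p ht hp => (hL p t ht hp).trans (le_max_left _ _)) (t - min 1 (t / 2)) t p
    (sub_pos.2 hτt) ⟨sub_le_self _ hτ.le, by linarith⟩ (by linarith)
  rw [sub_sub_cancel] at hle
  have hη : 5 / 16 ≤ cutoff (3 / 4) X t p := by rw [cutoff]; nlinarith [norm_nonneg (X p t)]
  rw [← hX.abs_scaled_le_iff ht, mul_assoc (√C / (5 / 16))]
  exact abs_le_of_mul_sq_mul_le (by norm_num) hη hC.le (by positivity) (one_le_min_mul_sq ht) hle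

end Estimate

end

theorem proposition3p4 (α : ℝ) (hα : 1 / 3 ≤ α) (β : ℝ) (hβ₀ : 0 < β) (hβ : β < 1 / α)
    (ε : ℝ) (hε₀ : 0 < ε) (hε : ε < min 1 β) (K L : ℝ) :
    ∃ C : ℝ, 0 < C ∧ ∀ X : ℝ → ℝ → Plane,
      IsAlphaCSF α X → EndsAsymptoticToLines (fun p => X p 0) →
      (∀ p t, 0 ≤ t → X p t ∈ Metric.ball (0 : Plane) 1 →
        |speedS α X t p| ≤ K * speed α X t p ^ β) →
      (∀ p t, 0 ≤ t → X p t ∈ Metric.ball (0 : Plane) 1 → speed α X t p ≤ L) →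
      ∀ p t, 0 < t → X p t ∈ Metric.ball (0 : Plane) (1 / 2) →
        |speedSS α X t p| ≤
          C * (1 + t ^ (-(1 / 2) : ℝ)) * speed α X t p ^ (min β (2 * β - 1) - ε) := by
  obtain ⟨C, hC, h⟩ :=
    proposition3p4_general (lt_of_lt_of_le (by norm_num) hα) hβ.le hε₀.le K L
  exact ⟨C, hC, fun X hX _ hK hL =>
    h X hX (fun p t ht => hK p t ht.le) (fun p t ht => hL p t ht.le)⟩
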